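/- Let $k$ be a field, let $q\in k$ be nonzero, and let $m,n$ be positive integers with $m\le n$. Let $\mathcal{O}_q(M_{mn})$ be the $k$-algebra generated by elements $X_{ij}$ ($1\le i\le m$, $1\le j\le n$) subject to the relations \[ \begin{array}{ll} X_{ij}X_{il}=q\,X_{il}X_{ij} & (1\le i\le m,\ 1\le j<l\le n),\\ X_{ij}X_{rj}=q\,X_{rj}X_{ij} & (1\le i<r\le m,\ 1\le j\le n),\\ X_{il}X_{rj}=X_{rj}X_{il} & (1\le i<r\le m,\ 1\le j<l\le n),\\ X_{ij}X_{rl}-X_{rl}X_{ij}=(q-q^{-1})X_{il}X_{rj} & (1\le i<r\le m,\ 1\le j<l\le n). \end{array} \] For $J=\{j_1<\dots<j_m\}\subseteq\{1,\dots,n\}$, let \[ [J]=\sum_{\sigma\in S_m}(-q)^{\ell(\sigma)}X_{1,j_{\sigma(1)}}\cdots X_{m,j_{\sigma(m)}} \] be the corresponding maximal quantum minor, where $\ell(\sigma)$ is the number of inversions of $\sigma$, and let the quantum grassmannian $\mathcal{G}_q(m,n)$ be the $k$-subalgebra of $\mathcal{O}_q(M_{mn})$ generated by all the $[J]$ with $J\subseteq\{1,\dots,n\}$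 and $|J|=m$. Then $\mathcal{G}_q(m,n)$ is a (left and right) noetherian domain. -/

import Mathlib

/-- The defining relations of the algebra of quantum `m × n` matrices, on the free algebra
on the letters `X (i, j)`. -/
inductive QMatRel {k : Type*} [Field k] (q : k) (m n : ℕ) :
    FreeAlgebra k (Fin m × Fin n) → FreeAlgebra k (Fin m × Fin n) → Prop
  | row (i : Fin m) (j l : Fin n) (hjl : j < l) :
      QMatRel q m n
        (FreeAlgebra.ι k (i, j) * FreeAlgebra.ι k (i, l))
        (q • (FreeAlgebra.ι k (i, l) * FreeAlgebra.ι k (i, j)))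
  | col (i r : Fin m) (j : Fin n) (hir : i < r) :
      QMatRel q m n
        (FreeAlgebra.ι k (i, j) * FreeAlgebra.ι k (r, j))
        (q • (FreeAlgebra.ι k (r, j) * FreeAlgebra.ι k (i, j)))
  | anti (i r : Fin m) (j l : Fin n) (hir : i < r) (hjl : j < l) :
      QMatRel q m n
        (FreeAlgebra.ι k (i, l) * FreeAlgebra.ι k (r, j))
        (FreeAlgebra.ι k (r, j) * FreeAlgebra.ι k (i, l))
  | diag (i r : Fin m) (j l : Fin n) (hir : i < r) (hjl : j < l) :
      QMatRel q m n
        (FreeAlgebra.ι k (i, j) * FreeAlgebra.ι k (r, l) -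
          FreeAlgebra.ι k (r, l) * FreeAlgebra.ι k (i, j))
        ((q - q⁻¹) • (FreeAlgebra.ι k (i, l) * FreeAlgebra.ι k (r, j)))

/-- The coordinate ring `O_q(M_{mn})` of quantum `m × n` matrices. -/
def QMat {k : Type*} [Field k] (q : k) (m n : ℕ) : Type _ :=
  RingQuot (QMatRel q m n)

noncomputable instance {k : Type*} [Field k] (q : k) (m n : ℕ) : Ring (QMat q m n) :=
  inferInstanceAs (Ring (RingQuot (QMatRel q m n)))

noncomputable instance {k : Type*} [Field k] (q : k) (m n : ℕ) : Algebra k (QMat q m n) :=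
  inferInstanceAs (Algebra k (RingQuot (QMatRel q m n)))

/-- The canonical generator `X_{ij}` of `O_q(M_{mn})`. -/
noncomputable def QMat.X {k : Type*} [Field k] (q : k) {m n : ℕ} (i : Fin m) (j : Fin n) :
    QMat q m n :=
  RingQuot.mkAlgHom k (QMatRel q m n) (FreeAlgebra.ι k (i, j))

/-- The length of a permutation, that is, its number of inversions. -/
def permLength {s : ℕ} (σ : Equiv.Perm (Fin s)) : ℕ :=
  (Finset.univ.filter fun p : Fin s × Fin s => p.1 < p.2 ∧ σ p.2 < σ p.1).card

/-- The `s × s` quantum minor `[I | J]`, where the index sets `I = {i_1 < ⋯ < i_s}` and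
`J = {j_1 < ⋯ < j_s}` are given by their increasing enumerations: the sum over all permutations
`σ` of `(-q)^{ℓ(σ)} X_{i_1, j_{σ(1)}} ⋯ X_{i_s, j_{σ(s)}}`. -/
noncomputable def QMat.minor {k : Type*} [Field k] (q : k) {m n s : ℕ}
    (I : Fin s ↪o Fin m) (J : Fin s ↪o Fin n) : QMat q m n :=
  ∑ σ : Equiv.Perm (Fin s),
    (-q) ^ permLength σ • (List.ofFn fun a : Fin s => QMat.X q (I a) (J (σ a))).prod

/-- The quantum grassmannian `G_q(m,n)`: the `k`-subalgebra of `O_q(M_{mn})` generated by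
the `m × m` quantum minors. -/
noncomputable def quantumGrassmannian {k : Type*} [Field k] (q : k) (m n : ℕ) :
    Subalgebra k (QMat q m n) :=
  Algebra.adjoin k
    {x | ∃ (I : Fin m ↪o Fin m) (J : Fin m ↪o Fin n), x = QMat.minor q I J}

/-!
**Noetherianity.** An algebra whose generators commute up to nonzero scalars and products of two
generators of smaller total weight is left and right noetherian: a left ideal is generated by
elements whose leading words have the minimal multisets of letters, and by Dickson's lemma there
are finitely many of these. For the maximal minors such relations come from a braided pair, that
is, two quantum exterior algebras with generators `e j` and `f j` commuting up to a Hecke braiding.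
The row sums `∑ j, X i j ⊗ e j` and `∑ j, X i j ⊗ f j` form a braided pair again. Their products
over all the rows, `∑ [J] ⊗ e J` and `∑ [J] ⊗ f J`, commute up to `q ^ m`. Reordering `f J * e I`
gives a multiple of `e I * f J` and terms `e I' * f J'` in which `J'` has smaller column sum, so
comparing the coefficients of the linearly independent monomials `e I * f J` gives
`[I][J] - c [J][I] ∈ span {[J'][I'] | columnSum J < columnSum J'}`.

**Absence of zero divisors.** It suffices to treat the algebra of quantum matrices, whose
generators also commute up to products of smaller weight, and to show that its ordered monomials
are linearly independent. For this the algebra acts on the span of arrays of occupation numbers,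
the generator `X i j` being a sum over lattice paths of products of `q`-oscillator operators; up
to nonzero scalars, the ordered monomials map the vacuum to distinct basis vectors.
-/

/-! ### Algebras whose generators quasi-commute up to lower terms -/

section QuasiCommuting

/-- The product `u i₁ * ⋯ * u iᵣ` of the letters of the word `[i₁, …, iᵣ]` in the family `u`. -/
def wordProd {ι A : Type*} [Monoid A] (u : ι → A) (w : List ι) : A := (w.map u).prod

section Monoid

variable {ι A : Type*} [Monoid A] (u : ι → A)

@[simp] lemma wordProd_nil : wordProd u [] = 1 := rfl

@[simp] lemma wordProd_cons (i : ι) (w : List ι) :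
    wordProd u (i :: w) = u i * wordProd u w :=
  List.prod_cons

@[simp] lemma wordProd_append (v w : List ι) :
    wordProd u (v ++ w) = wordProd u v * wordProd u w := by
  simp [wordProd]

end Monoid

variable {k A ι Γ : Type*} [Field k] [Ring A] [Algebra k A]

lemma span_range_wordProd_eq_top {u : ι → A} (hu : Algebra.adjoin k (Set.range u) = ⊤) :
    Submodule.span k (Set.range (wordProd u)) = ⊤ := by
  rw [← top_le_iff, ← Algebra.top_toSubmodule, ← hu, Algebra.adjoin_eq_span]
  refine Submodule.span_mono fun x hx => ?_
  induction hx using Submonoid.closure_induction with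
  | mem x hx =>
    obtain ⟨i, rfl⟩ := hx
    exact ⟨[i], by simp⟩
  | one => exact ⟨[], rfl⟩
  | mul x y _ _ hx hy =>
    obtain ⟨v, rfl⟩ := hx
    obtain ⟨w, rfl⟩ := hy
    exact ⟨v ++ w, wordProd_append u v w⟩

lemma adjoin_range_op_eq_top {u : ι → A} (hu : Algebra.adjoin k (Set.range u) = ⊤) :
    Algebra.adjoin k (Set.range fun i => MulOpposite.op (u i)) = ⊤ := by
  rw [eq_top_iff]
  rintro ⟨x⟩ -
  change MulOpposite.op x ∈ _
  have hx : x ∈ Algebra.adjoin k (Set.range u) := hu ▸ Algebra.mem_top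
  induction hx using Algebra.adjoin_induction with
  | mem y hy =>
    obtain ⟨i, rfl⟩ := hy
    exact Algebra.subset_adjoin ⟨i, rfl⟩
  | algebraMap r => exact Subalgebra.algebraMap_mem _ r
  | add y z _ _ hy hz => exact add_mem hy hz
  | mul y z _ _ hy hz => exact mul_mem hz hy

variable [AddCommMonoid Γ] [LinearOrder Γ]

/-- The span of the words whose key is smaller than `γ`. A key is an additive function of the
multiset of letters of a word, so that it does not see the order of the letters. -/
def lowerSpan (k : Type*) {A ι Γ : Type*} [Field k] [Ring A] [Algebra k A]
    [AddCommMonoid Γ] [LinearOrder Γ] (u : ι → A) (κ : Multiset ι →+ Γ) (γ : Γ) :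
    Submodule k A :=
  Submodule.span k (wordProd u '' {w | κ w < γ})

/-- The letters of the family `u` commute pairwise up to a nonzero scalar and words of smaller
key. -/
def QuasiCommutes (k : Type*) {A ι Γ : Type*} [Field k] [Ring A] [Algebra k A]
    [AddCommMonoid Γ] [LinearOrder Γ] (u : ι → A) (κ : Multiset ι →+ Γ) : Prop :=
  ∀ i j, ∃ c : k, c ≠ 0 ∧ u i * u j - c • (u j * u i) ∈ lowerSpan k u κ (κ {i, j})

variable {u : ι → A} {κ : Multiset ι →+ Γ}

lemma wordProd_mem_lowerSpan {w : List ι} {γ : Γ} (h : κ w < γ) :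
    wordProd u w ∈ lowerSpan k u κ γ :=
  Submodule.subset_span ⟨w, h, rfl⟩

lemma lowerSpan_mono {γ γ' : Γ} (h : γ ≤ γ') : lowerSpan k u κ γ ≤ lowerSpan k u κ γ' :=
  Submodule.span_mono (Set.image_mono fun _ hw => lt_of_lt_of_le hw h)

lemma exists_mem_lowerSpan [NoMaxOrder Γ] (hu : Algebra.adjoin k (Set.range u) = ⊤) (x : A) :
    ∃ γ, x ∈ lowerSpan k u κ γ := by
  have hx : x ∈ Submodule.span k (Set.range (wordProd u)) :=
    span_range_wordProd_eq_top hu ▸ Submodule.mem_top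
  induction hx using Submodule.span_induction with
  | mem x hx =>
    obtain ⟨w, rfl⟩ := hx
    obtain ⟨γ, hγ⟩ := exists_gt (κ w)
    exact ⟨γ, wordProd_mem_lowerSpan hγ⟩
  | zero => exact ⟨0, zero_mem _⟩
  | add x y _ _ hx hy =>
    obtain ⟨γ, h⟩ := hx
    obtain ⟨γ', h'⟩ := hy
    exact ⟨max γ γ', add_mem (lowerSpan_mono (le_max_left _ _) h)
      (lowerSpan_mono (le_max_right _ _) h')⟩
  | smul c x _ hx =>
    obtain ⟨γ, h⟩ := hx
    exact ⟨γ, Submodule.smul_mem _ c h⟩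

lemma exists_mem_span_wordProd_le {γ : Γ} {x : A} (hx : x ∈ lowerSpan k u κ γ) (hx₀ : x ≠ 0) :
    ∃ w : List ι, κ w < γ ∧ x ∈ Submodule.span k (wordProd u '' {v | κ v ≤ κ w}) := by
  suffices x = 0 ∨ ∃ w : List ι, κ w < γ ∧
      x ∈ Submodule.span k (wordProd u '' {v | κ v ≤ κ w}) from this.resolve_left hx₀
  clear hx₀
  induction hx using Submodule.span_induction with
  | mem x hx =>
    obtain ⟨w, hw, rfl⟩ := hx
    exact .inr ⟨w, hw, Submodule.subset_span ⟨w, le_refl (κ w), rfl⟩⟩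
  | zero => exact .inl rfl
  | add x y _ _ hx hy =>
    obtain rfl | ⟨v, hv, hxv⟩ := hx
    · rwa [zero_add]
    obtain rfl | ⟨w, hw, hyw⟩ := hy
    · exact .inr ⟨v, hv, by rwa [add_zero]⟩
    have hmono {v w : List ι} (h : κ v ≤ κ w) :
        Submodule.span k (wordProd u '' {t | κ t ≤ κ v}) ≤
          Submodule.span k (wordProd u '' {t | κ t ≤ κ w}) :=
      Submodule.span_mono (Set.image_mono fun _ ht => le_trans ht h)
    obtain h | h := le_total (κ v) (κ w)
    · exact .inr ⟨w, hw, add_mem (hmono h hxv) hyw⟩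
    · exact .inr ⟨v, hv, add_mem hxv (hmono h hyw)⟩
  | smul a x _ hx =>
    obtain rfl | ⟨v, hv, hxv⟩ := hx
    · exact .inl (smul_zero a)
    · exact .inr ⟨v, hv, Submodule.smul_mem _ a hxv⟩

lemma op_mem_lowerSpan {x : A} {γ : Γ} (hx : x ∈ lowerSpan k u κ γ) :
    MulOpposite.op x ∈ lowerSpan k (fun i => MulOpposite.op (u i)) κ γ := by
  induction hx using Submodule.span_induction with
  | mem x hx =>
    obtain ⟨w, hw, rfl⟩ := hx
    refine Submodule.subset_span ⟨w.reverse, by simpa using hw, ?_⟩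
    simp [wordProd, MulOpposite.op_list_prod, List.map_map, Function.comp_def]
  | zero => exact zero_mem _
  | add x y _ _ hx hy => exact add_mem hx hy
  | smul c x _ hx => exact Submodule.smul_mem _ c hx

lemma QuasiCommutes.op (H : QuasiCommutes k u κ) :
    QuasiCommutes k (fun i => MulOpposite.op (u i)) κ := by
  intro i j
  obtain ⟨c, hc, h⟩ := H j i
  exact ⟨c, hc, Multiset.pair_comm i j ▸ op_mem_lowerSpan h⟩

variable [IsOrderedCancelAddMonoid Γ]

lemma wordProd_mul_mem_lowerSpan (v : List ι) {x : A} {γ : Γ} (hx : x ∈ lowerSpan k u κ γ) :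
    wordProd u v * x ∈ lowerSpan k u κ (κ v + γ) := by
  induction hx using Submodule.span_induction with
  | mem x hx =>
    obtain ⟨w, hw, rfl⟩ := hx
    rw [← wordProd_append]
    apply wordProd_mem_lowerSpan
    rw [← Multiset.coe_add, map_add]
    exact add_lt_add_right hw _
  | zero => simp
  | add x y _ _ hx hy => exact mul_add (wordProd u v) x y ▸ add_mem hx hy
  | smul c x _ hx => exact mul_smul_comm c (wordProd u v) x ▸ Submodule.smul_mem _ c hx

lemma mul_wordProd_mem_lowerSpan (v : List ι) {x : A} {γ : Γ} (hx : x ∈ lowerSpan k u κ γ) :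
    x * wordProd u v ∈ lowerSpan k u κ (γ + κ v) := by
  induction hx using Submodule.span_induction with
  | mem x hx =>
    obtain ⟨w, hw, rfl⟩ := hx
    rw [← wordProd_append]
    apply wordProd_mem_lowerSpan
    rw [← Multiset.coe_add, map_add]
    exact add_lt_add_left hw _
  | zero => simp
  | add x y _ _ hx hy => exact add_mul x y (wordProd u v) ▸ add_mem hx hy
  | smul c x _ hx => exact smul_mul_assoc c x (wordProd u v) ▸ Submodule.smul_mem _ c hx

lemma mul_mem_lowerSpan {x y : A} {γ γ' : Γ} (hx : x ∈ lowerSpan k u κ γ)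
    (hy : y ∈ lowerSpan k u κ γ') : x * y ∈ lowerSpan k u κ (γ + γ') := by
  induction hx using Submodule.span_induction with
  | mem x hx =>
    obtain ⟨w, hw, rfl⟩ := hx
    exact lowerSpan_mono (add_le_add_left (le_of_lt hw) γ') (wordProd_mul_mem_lowerSpan w hy)
  | zero => simp
  | add x z _ _ hx hz => exact add_mul x z y ▸ add_mem hx hz
  | smul c x _ hx => exact smul_mul_assoc c x y ▸ Submodule.smul_mem _ c hx

lemma QuasiCommutes.wordProd_perm (H : QuasiCommutes k u κ) {v w : List ι} (h : v.Perm w) :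
    ∃ c : k, c ≠ 0 ∧ wordProd u v - c • wordProd u w ∈ lowerSpan k u κ (κ v) := by
  induction h with
  | nil => exact ⟨1, one_ne_zero, by simp⟩
  | @cons a v w _ ih =>
    obtain ⟨c, hc, h⟩ := ih
    refine ⟨c, hc, ?_⟩
    have := wordProd_mul_mem_lowerSpan [a] h
    rw [← map_add, Multiset.coe_add] at this
    simpa [mul_sub] using this
  | swap a b v =>
    obtain ⟨c, hc, h⟩ := H b a
    refine ⟨c, hc, ?_⟩
    have := mul_wordProd_mem_lowerSpan v h
    rw [← map_add] at this
    simpa [sub_mul, mul_assoc] using this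
  | @trans v w x hvw _ ih₁ ih₂ =>
    obtain ⟨c, hc, h₁⟩ := ih₁
    obtain ⟨d, hd, h₂⟩ := ih₂
    refine ⟨c * d, mul_ne_zero hc hd, ?_⟩
    rw [← Multiset.coe_eq_coe.2 hvw] at h₂
    have := add_mem h₁ (Submodule.smul_mem _ c h₂)
    rwa [smul_sub, sub_add_sub_cancel, smul_smul] at this

lemma QuasiCommutes.lowerSpan_le [WellFoundedLT Γ] (H : QuasiCommutes k u κ)
    {N : Submodule k A} (γ : Γ)
    (hN : ∀ w : List ι, κ w < γ → ∃ w', w.Perm w' ∧ wordProd u w' ∈ N) :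
    lowerSpan k u κ γ ≤ N := by
  induction γ using WellFoundedLT.induction with
  | ind γ ih =>
    refine Submodule.span_le.2 ?_
    rintro _ ⟨w, hw, rfl⟩
    obtain ⟨w', hperm, hw'⟩ := hN w hw
    obtain ⟨c, -, hc⟩ := H.wordProd_perm hperm
    have hlower := ih (κ w) hw (fun v hv => hN v (hv.trans hw)) hc
    exact (N.sub_mem_iff_left (N.smul_mem c hw')).1 hlower

lemma QuasiCommutes.exists_sub_smul_wordProd_mem (H : QuasiCommutes k u κ)
    (hκ : Function.Injective κ) {w : List ι} {x : A}
    (hx : x ∈ Submodule.span k (wordProd u '' {v | κ v ≤ κ w})) :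
    ∃ c : k, x - c • wordProd u w ∈ lowerSpan k u κ (κ w) := by
  induction hx using Submodule.span_induction with
  | mem x hx =>
    obtain ⟨v, hv, rfl⟩ := hx
    obtain hlt | heq := lt_or_eq_of_le hv
    · exact ⟨0, by simpa using wordProd_mem_lowerSpan hlt⟩
    · obtain ⟨c, -, hc⟩ := H.wordProd_perm (Multiset.coe_eq_coe.1 (hκ heq))
      exact ⟨c, heq ▸ hc⟩
  | zero => exact ⟨0, by simp⟩
  | add x y _ _ hx hy =>
    obtain ⟨c, hc⟩ := hx
    obtain ⟨d, hd⟩ := hy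
    refine ⟨c + d, ?_⟩
    rw [add_smul, add_sub_add_comm]
    exact add_mem hc hd
  | smul a x _ hx =>
    obtain ⟨c, hc⟩ := hx
    refine ⟨a * c, ?_⟩
    rw [mul_smul, ← smul_sub]
    exact Submodule.smul_mem _ a hc

lemma QuasiCommutes.exists_leading [WellFoundedLT Γ] (H : QuasiCommutes k u κ)
    (hκ : Function.Injective κ) {γ : Γ} {x : A} (hx : x ∈ lowerSpan k u κ γ) (hx₀ : x ≠ 0) :
    ∃ w : List ι, κ w < γ ∧
      ∃ c : k, c ≠ 0 ∧ x - c • wordProd u w ∈ lowerSpan k u κ (κ w) := by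
  induction γ using WellFoundedLT.induction with
  | ind γ ih =>
    obtain ⟨w, hw, hxw⟩ := exists_mem_span_wordProd_le hx hx₀
    obtain ⟨c, hc⟩ := H.exists_sub_smul_wordProd_mem hκ hxw
    obtain rfl | hc₀ := eq_or_ne c 0
    · obtain ⟨v, hv, h⟩ := ih (κ w) hw (by simpa using hc)
      exact ⟨v, hv.trans hw, h⟩
    · exact ⟨w, hw, c, hc₀, hc⟩

lemma exists_finset_le_of_mem [Finite ι] (S : Set (Multiset ι)) :
    ∃ B : Finset (Multiset ι), ↑B ⊆ S ∧ ∀ s ∈ S, ∃ b ∈ B, b ≤ s := by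
  classical
  have : WellQuasiOrderedLE (Multiset ι) :=
    (OrderIso.wellQuasiOrderedLE_iff (Finsupp.orderIsoMultiset (ι := ι))).1 inferInstance
  have hfin := WellQuasiOrderedLE.finite_of_isAntichain (setOfPred_minimal_antichain (· ∈ S))
  refine ⟨hfin.toFinset, fun b hb => ?_, fun s hs => ?_⟩
  · exact (hfin.mem_toFinset.1 hb).prop
  · obtain ⟨b, hb, hm⟩ := exists_minimal_le_of_wellFoundedLT (· ∈ S) s hs
    exact ⟨b, hfin.mem_toFinset.2 hm, hb⟩

lemma QuasiCommutes.exists_sub_smul_mul_mem (H : QuasiCommutes k u κ) {x g : A} {c : k}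
    {v w : List ι} (hx : x - c • wordProd u w ∈ lowerSpan k u κ (κ w))
    (hg : g - wordProd u v ∈ lowerSpan k u κ (κ v)) (hvw : (v : Multiset ι) ≤ w) :
    ∃ a : A, x - a * g ∈ lowerSpan k u κ (κ w) := by
  obtain ⟨t, ht⟩ := Multiset.le_iff_exists_add.1 hvw
  induction t using Quotient.inductionOn with
  | h t =>
    replace ht : ((t ++ v : List ι) : Multiset ι) = w := by
      rw [ht, ← Multiset.coe_add, add_comm]
      rfl
    obtain ⟨d, hd, hdw⟩ := H.wordProd_perm (Multiset.coe_eq_coe.1 ht)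
    have hmul : wordProd u t * g - wordProd u (t ++ v) ∈ lowerSpan k u κ (κ w) := by
      have := wordProd_mul_mem_lowerSpan t hg
      rwa [← map_add, Multiset.coe_add, ht, mul_sub, ← wordProd_append] at this
    rw [ht] at hdw
    refine ⟨(c * d⁻¹) • wordProd u t, ?_⟩
    convert sub_mem hx (Submodule.smul_mem _ (c * d⁻¹) (add_mem hmul hdw)) using 1
    rw [sub_add_sub_cancel, smul_sub, smul_smul, inv_mul_cancel_right₀ hd, smul_mul_assoc]
    abel

lemma QuasiCommutes.le_span_of_leading [WellFoundedLT Γ] [NoMaxOrder Γ]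
    (H : QuasiCommutes k u κ) (hκ : Function.Injective κ)
    (hu : Algebra.adjoin k (Set.range u) = ⊤) {I : Submodule A A} {G : Set A} (hGI : G ⊆ I)
    (hG : ∀ x ∈ I, ∀ w : List ι, x - wordProd u w ∈ lowerSpan k u κ (κ w) →
      ∃ g ∈ G, ∃ v : List ι, (v : Multiset ι) ≤ w ∧ g - wordProd u v ∈ lowerSpan k u κ (κ v)) :
    I ≤ Submodule.span A G := by
  intro x hxI
  obtain ⟨γ, hx⟩ := exists_mem_lowerSpan (κ := κ) hu x
  induction γ using WellFoundedLT.induction generalizing x with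
  | ind γ ih =>
    obtain rfl | hx₀ := eq_or_ne x 0
    · exact zero_mem _
    obtain ⟨w, hw, c, hc₀, hc⟩ := H.exists_leading hκ hx hx₀
    have hmonic : c⁻¹ • x - wordProd u w ∈ lowerSpan k u κ (κ w) := by
      have := Submodule.smul_mem _ c⁻¹ hc
      rwa [smul_sub, inv_smul_smul₀ hc₀] at this
    obtain ⟨g, hgG, v, hvw, hg⟩ := hG _ (I.smul_of_tower_mem c⁻¹ hxI) w hmonic
    obtain ⟨a, ha⟩ := H.exists_sub_smul_mul_mem hc hg hvw
    have hrest := ih (κ w) hw (sub_mem hxI (I.smul_mem a (hGI hgG))) ha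
    exact (Submodule.sub_mem_iff_left _
      (Submodule.smul_mem _ a (Submodule.subset_span hgG))).1 hrest

theorem QuasiCommutes.isNoetherianRing [Finite ι] [WellFoundedLT Γ] [NoMaxOrder Γ]
    (H : QuasiCommutes k u κ) (hκ : Function.Injective κ)
    (hu : Algebra.adjoin k (Set.range u) = ⊤) : IsNoetherianRing A := by
  refine ⟨fun I => ?_⟩
  obtain ⟨B, hBS, hB⟩ := exists_finset_le_of_mem {s : Multiset ι | ∃ x ∈ I, ∃ w : List ι,
    (w : Multiset ι) = s ∧ x - wordProd u w ∈ lowerSpan k u κ (κ w)}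
  have hB' : ∀ b ∈ B, ∃ x ∈ I, ∃ w : List ι,
      (w : Multiset ι) = b ∧ x - wordProd u w ∈ lowerSpan k u κ (κ w) := fun b hb => hBS hb
  choose! g hgI v hv hg using hB'
  have hle : I ≤ Submodule.span A (g '' B) := by
    refine H.le_span_of_leading hκ hu (Set.image_subset_iff.2 hgI) fun x hxI w hx => ?_
    obtain ⟨b, hbB, hbw⟩ := hB w ⟨x, hxI, w, rfl, hx⟩
    exact ⟨g b, ⟨b, hbB, rfl⟩, v b, (hv b hbB).trans_le hbw, hg b hbB⟩
  rw [hle.antisymm (Submodule.span_le.2 (Set.image_subset_iff.2 hgI))]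
  exact Submodule.fg_span (B.finite_toSet.image g)

theorem QuasiCommutes.noZeroDivisors [WellFoundedLT Γ] [NoMaxOrder Γ] (H : QuasiCommutes k u κ)
    (hκ : Function.Injective κ) (hu : Algebra.adjoin k (Set.range u) = ⊤)
    (hlead : ∀ w : List ι, wordProd u w ∉ lowerSpan k u κ (κ w)) : NoZeroDivisors A := by
  refine ⟨fun {x y} hxy => ?_⟩
  by_contra! hne
  obtain ⟨γ, hx⟩ := exists_mem_lowerSpan (κ := κ) hu x
  obtain ⟨δ, hy⟩ := exists_mem_lowerSpan (κ := κ) hu y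
  obtain ⟨v, -, c, hc, hv⟩ := H.exists_leading hκ hx hne.1
  obtain ⟨w, -, d, hd, hw⟩ := H.exists_leading hκ hy hne.2
  have hmul : x * y - (c * d) • wordProd u (v ++ w) =
      (x - c • wordProd u v) * (y - d • wordProd u w)
        + c • (wordProd u v * (y - d • wordProd u w))
        + d • ((x - c • wordProd u v) * wordProd u w) := by
    simp only [wordProd_append, mul_sub, sub_mul, smul_sub, smul_mul_assoc, mul_smul_comm]
    module
  have hmem : x * y - (c * d) • wordProd u (v ++ w) ∈ lowerSpan k u κ (κ ↑(v ++ w)) := by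
    rw [hmul, ← Multiset.coe_add, map_add]
    exact add_mem (add_mem (mul_mem_lowerSpan hv hw)
      (Submodule.smul_mem _ c (wordProd_mul_mem_lowerSpan v hw)))
      (Submodule.smul_mem _ d (mul_wordProd_mem_lowerSpan w hv))
  rw [hxy, zero_sub, neg_mem_iff, Submodule.smul_mem_iff _ (mul_ne_zero hc hd)] at hmem
  exact hlead (v ++ w) hmem

end QuasiCommuting

section Weighted

variable {k A ι : Type*} [Field k] [Ring A] [Algebra k A]

/-- The key comparing words by weight first, and by their multisets of letters, ordered
lexicographically, if the weights agree. -/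
noncomputable def weightKey [LinearOrder ι] (wt : ι → ℕ) :
    Multiset ι →+ ℕ ×ₗ Lex (ι →₀ ℕ) where
  toFun s := toLex ((s.map wt).sum, toLex (Multiset.toFinsupp s))
  map_zero' := by simp
  map_add' s t := by
    rw [Multiset.map_add, Multiset.sum_add, map_add]
    rfl

lemma weightKey_injective [LinearOrder ι] (wt : ι → ℕ) : Function.Injective (weightKey wt) :=
  fun _ _ h => Multiset.toFinsupp.injective (congrArg (fun x => ofLex (ofLex x).2) h)

/-- The letters of the family `u` commute pairwise up to a nonzero scalar and products of two
letters of smaller total weight. -/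
def WeightedQuasiCommutes (k : Type*) {A ι : Type*} [Field k] [Ring A] [Algebra k A]
    (u : ι → A) (wt : ι → ℕ) : Prop :=
  ∀ i j, ∃ c : k, c ≠ 0 ∧ u i * u j - c • (u j * u i) ∈
    Submodule.span k {x | ∃ a b, wt a + wt b < wt i + wt j ∧ x = u a * u b}

lemma WeightedQuasiCommutes.quasiCommutes [LinearOrder ι] {u : ι → A} {wt : ι → ℕ}
    (H : WeightedQuasiCommutes k u wt) : QuasiCommutes k u (weightKey wt) := by
  intro i j
  obtain ⟨c, hc, h⟩ := H i j
  refine ⟨c, hc, Submodule.span_mono ?_ h⟩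
  rintro _ ⟨a, b, hab, rfl⟩
  refine ⟨[a, b], Prod.Lex.lt_iff.2 (.inl ?_), by simp⟩
  simpa [weightKey] using hab

theorem WeightedQuasiCommutes.isNoetherianRing [Finite ι] {u : ι → A} {wt : ι → ℕ}
    (H : WeightedQuasiCommutes k u wt) (hu : Algebra.adjoin k (Set.range u) = ⊤) :
    IsNoetherianRing A ∧ IsNoetherianRing Aᵐᵒᵖ := by
  obtain ⟨n, ⟨e⟩⟩ := Finite.exists_equiv_fin ι
  let _ : LinearOrder ι := LinearOrder.lift' e e.injective
  exact ⟨H.quasiCommutes.isNoetherianRing (weightKey_injective wt) hu,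
    H.quasiCommutes.op.isNoetherianRing (weightKey_injective wt) (adjoin_range_op_eq_top hu)⟩

lemma WeightedQuasiCommutes.of_map {B : Type*} [Ring B] [Algebra k B] {u : ι → A} {wt : ι → ℕ}
    {φ : A →ₐ[k] B} (hφ : Function.Injective φ) (H : WeightedQuasiCommutes k (φ ∘ u) wt) :
    WeightedQuasiCommutes k u wt := by
  intro i j
  obtain ⟨c, hc, h⟩ := H i j
  refine ⟨c, hc, ?_⟩
  rw [← Submodule.comap_map_eq_of_injective (f := φ.toLinearMap) hφ (Submodule.span k _),
    Submodule.mem_comap, Submodule.map_span, AlgHom.toLinearMap_apply, map_sub, map_smul, map_mul,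
    map_mul]
  refine Submodule.span_mono ?_ h
  rintro _ ⟨a, b, hab, rfl⟩
  exact ⟨u a * u b, ⟨a, b, hab, rfl⟩, map_mul φ _ _⟩

theorem WeightedQuasiCommutes.isNoetherianRing_adjoin [Finite ι] {u : ι → A} {wt : ι → ℕ}
    (H : WeightedQuasiCommutes k u wt) :
    IsNoetherianRing (Algebra.adjoin k (Set.range u)) ∧
      IsNoetherianRing (Algebra.adjoin k (Set.range u))ᵐᵒᵖ := by
  let v (i : ι) : Algebra.adjoin k (Set.range u) := ⟨u i, Algebra.subset_adjoin ⟨i, rfl⟩⟩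
  have hv : Set.range v = (↑) ⁻¹' Set.range u := by
    ext x
    simp [v, Subtype.ext_iff]
  refine WeightedQuasiCommutes.isNoetherianRing (u := v) (wt := wt)
    (.of_map (φ := Subalgebra.val _) Subtype.val_injective H) ?_
  rw [hv, Algebra.adjoin_adjoin_coe_preimage]

theorem WeightedQuasiCommutes.noZeroDivisors [Finite ι] {P : Type*} {u : ι → A} {wt : ι → ℕ}
    (H : WeightedQuasiCommutes k u wt) (hu : Algebra.adjoin k (Set.range u) = ⊤)
    {π : Multiset ι → P} (hπ : Function.Injective π) (φ : A →ₗ[k] P →₀ k)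
    (hφ : ∀ s, ∃ w : List ι, ↑w = s ∧ ∃ c ≠ 0, φ (wordProd u w) = Finsupp.single (π s) c) :
    NoZeroDivisors A := by
  obtain ⟨n, ⟨e⟩⟩ := Finite.exists_equiv_fin ι
  let _ : LinearOrder ι := LinearOrder.lift' e e.injective
  refine H.quasiCommutes.noZeroDivisors (weightKey_injective wt) hu fun w hw => ?_
  let N : Submodule k A := (Finsupp.lapply (π w) ∘ₗ φ).ker
  have hN : lowerSpan k u (weightKey wt) (weightKey wt w) ≤ N := by
    refine H.quasiCommutes.lowerSpan_le _ fun v hv => ?_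
    obtain ⟨v', hv', c, -, h⟩ := hφ v
    have hvw : π v ≠ π w := fun h => hv.ne (congrArg _ (hπ h))
    exact ⟨v', (Multiset.coe_eq_coe.1 hv').symm, by simp [N, h, hvw]⟩
  obtain ⟨w', hw', c, hc, h⟩ := hφ w
  obtain ⟨d, hd, hdw⟩ := H.quasiCommutes.wordProd_perm (Multiset.coe_eq_coe.1 hw').symm
  have hmem : d • wordProd u w' ∈ N := by
    rw [← sub_sub_cancel (wordProd u w) (d • wordProd u w')]
    exact N.sub_mem (hN hw) (hN hdw)
  rw [Submodule.smul_mem_iff _ hd] at hmem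
  exact hc (by simpa [N, h] using hmem)

end Weighted

/-! ### Quantum matrices and quantum exterior algebras -/

section Relations

/-- The coefficients of the Hecke braiding `v_a ⊗ v_b ↦ v_b ⊗ v_a + braidCoeff q a b • v_a ⊗ v_b`.
They allow to write the defining relations of quantum matrices uniformly in all the indices. -/
def braidCoeff {k α : Type*} [Field k] [LinearOrder α] (q : k) (a b : α) : k :=
  if a < b then q - q⁻¹ else if a = b then q - 1 else 0

/-- The relations of quantum matrices. For `i = r` they are the row relations, for `j = l` the
column relations, and in the other cases the relations between the entries of `2 × 2` minors. -/
def IsQuantumMatrix {k A α β : Type*} [Field k] [Ring A] [Algebra k A] [LinearOrder α]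
    [LinearOrder β] (q : k) (x : α → β → A) : Prop :=
  ∀ i r j l, x r j * x i l + braidCoeff q i r • (x i j * x r l) =
    x i l * x r j + braidCoeff q j l • (x i j * x r l)

/-- The relations of the quantum exterior algebra. -/
structure IsQuantumExterior {k A β : Type*} [Field k] [Ring A] [Algebra k A] [LT β]
    (q : k) (e : β → A) : Prop where
  sq : ∀ j, e j * e j = 0
  anti : ∀ {j l}, j < l → e l * e j = (-q) • (e j * e l)

/-- Two families generating quantum exterior algebras, with the letters of the first moving to
the right of the letters of the second by means of the Hecke braiding. -/
structure IsBraidedPair {k A β : Type*} [Field k] [Ring A] [Algebra k A] [LinearOrder β]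
    (q : k) (e f : β → A) : Prop where
  left : IsQuantumExterior q e
  right : IsQuantumExterior q f
  braid : ∀ j l, e j * f l = f l * e j + braidCoeff q j l • (f j * e l)

lemma sum_mul_sum_of_commute {A α β : Type*} [Ring A] {x : α → β → A} {e f : β → A}
    (s : Finset β) (i r : α) (hxe : ∀ i j l, Commute (x i j) (e l)) :
    (∑ j ∈ s, x i j * e j) * ∑ l ∈ s, x r l * f l =
      ∑ j ∈ s, ∑ l ∈ s, x i j * x r l * (e j * f l) := by
  simp only [Finset.sum_mul_sum]
  refine Finset.sum_congr rfl fun j _ => Finset.sum_congr rfl fun l _ => ?_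
  rw [mul_assoc, ← mul_assoc (e j), ← (hxe r l j).eq, mul_assoc, mul_assoc]

variable {k A B α β : Type*} [Field k] [Ring A] [Algebra k A] [Ring B] [Algebra k B]
variable [LinearOrder α] [LinearOrder β] {q : k}

@[simp] lemma braidCoeff_self (a : α) : braidCoeff q a a = q - 1 := by
  simp [braidCoeff]

lemma braidCoeff_of_lt {a b : α} (h : a < b) : braidCoeff q a b = q - q⁻¹ := if_pos h

lemma braidCoeff_of_gt {a b : α} (h : b < a) : braidCoeff q a b = 0 := by
  rw [braidCoeff, if_neg h.not_gt, if_neg h.ne']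

lemma braidCoeff_apply_of_strictMono {f : α → β} (hf : StrictMono f) (a b : α) :
    braidCoeff q (f a) (f b) = braidCoeff q a b := by
  simp only [braidCoeff, hf.lt_iff_lt, hf.injective.eq_iff]

namespace IsQuantumMatrix

variable {x : α → β → A}

lemma map (hx : IsQuantumMatrix q x) (φ : A →ₐ[k] B) :
    IsQuantumMatrix q fun i j => φ (x i j) := by
  intro i r j l
  simpa only [map_add, map_mul, map_smul] using congrArg φ (hx i r j l)

lemma reindex {α' β' : Type*} [LinearOrder α'] [LinearOrder β'] (hx : IsQuantumMatrix q x)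
    {f : α' → α} {g : β' → β} (hf : StrictMono f) (hg : StrictMono g) :
    IsQuantumMatrix q fun i j => x (f i) (g j) := by
  intro i r j l
  simpa only [braidCoeff_apply_of_strictMono hf, braidCoeff_apply_of_strictMono hg]
    using hx (f i) (f r) (g j) (g l)

lemma row (hx : IsQuantumMatrix q x) (i : α) {j l : β} (hjl : j < l) :
    x i j * x i l = q • (x i l * x i j) := by
  have h := hx i i l j
  rw [braidCoeff_self, braidCoeff_of_gt hjl, zero_smul, add_zero] at h
  rw [← h]
  module

lemma col (hx : IsQuantumMatrix q x) {i r : α} (hir : i < r) (j : β) :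
    x i j * x r j = q • (x r j * x i j) := by
  have h := hx r i j j
  rw [braidCoeff_self, braidCoeff_of_gt hir, zero_smul, add_zero] at h
  rw [h]
  module

lemma anti (hx : IsQuantumMatrix q x) {i r : α} (hir : i < r) {j l : β} (hjl : j < l) :
    x i l * x r j = x r j * x i l := by
  have h := hx i r j l
  rw [braidCoeff_of_lt hir, braidCoeff_of_lt hjl] at h
  exact (add_right_cancel h).symm

lemma diag (hx : IsQuantumMatrix q x) {i r : α} (hir : i < r) {j l : β} (hjl : j < l) :
    x i j * x r l - x r l * x i j = (q - q⁻¹) • (x i l * x r j) := by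
  have h := hx i r l j
  rw [braidCoeff_of_lt hir, braidCoeff_of_gt hjl, zero_smul, add_zero] at h
  rw [← h, add_sub_cancel_left]

lemma of_relations (hq : q ≠ 0)
    (row : ∀ i {j l}, j < l → x i j * x i l = q • (x i l * x i j))
    (col : ∀ {i r} (_ : i < r) j, x i j * x r j = q • (x r j * x i j))
    (anti : ∀ {i r} (_ : i < r) {j l}, j < l → x i l * x r j = x r j * x i l)
    (diag : ∀ {i r} (_ : i < r) {j l}, j < l →
      x i j * x r l - x r l * x i j = (q - q⁻¹) • (x i l * x r j)) :
    IsQuantumMatrix q x := by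
  intro i r j l
  obtain hir | rfl | hri := lt_trichotomy i r <;> obtain hjl | rfl | hlj := lt_trichotomy j l
  · rw [braidCoeff_of_lt hir, braidCoeff_of_lt hjl, anti hir hjl]
  · rw [braidCoeff_of_lt hir, braidCoeff_self, col hir]
    match_scalars
    · field_simp
      ring
  · rw [braidCoeff_of_lt hir, braidCoeff_of_gt hlj, ← diag hir hlj]
    module
  · rw [braidCoeff_of_lt hjl, braidCoeff_self, row i hjl]
    match_scalars
    · field_simp
      ring
  · rw [braidCoeff_self, braidCoeff_self]
  · rw [braidCoeff_of_gt hlj, braidCoeff_self, row i hlj]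
    module
  · rw [braidCoeff_of_gt hri, braidCoeff_of_lt hjl, ← anti hri hjl, ← diag hri hjl]
    module
  · rw [braidCoeff_of_gt hri, braidCoeff_self, col hri]
    module
  · rw [braidCoeff_of_gt hri, braidCoeff_of_gt hlj, anti hri hlj]

lemma sum_braid (hx : IsQuantumMatrix q x) (s : Finset β) (i r : α) (g : β → β → A) :
    ∑ j ∈ s, ∑ l ∈ s, x r j * x i l * g j l +
        braidCoeff q i r • ∑ j ∈ s, ∑ l ∈ s, x i j * x r l * g j l =
      ∑ j ∈ s, ∑ l ∈ s, x i j * x r l * (g l j + braidCoeff q j l • g j l) := by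
  calc _ = ∑ j ∈ s, ∑ l ∈ s, (x r j * x i l + braidCoeff q i r • (x i j * x r l)) * g j l := by
        simp only [add_mul, Finset.sum_add_distrib, Finset.smul_sum, smul_mul_assoc]
    _ = ∑ j ∈ s, ∑ l ∈ s, (x i l * x r j + braidCoeff q j l • (x i j * x r l)) * g j l := by
        simp only [hx i r]
    _ = _ := by
        simp only [add_mul, mul_add, Finset.sum_add_distrib, smul_mul_assoc, mul_smul_comm]
        rw [Finset.sum_comm]

/-- `z` is the matrix product of `x` and `y`, each entry being a finite sum over the possibly
infinite index set `β`. -/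
lemma of_eq_sum_mul {γ : Type*} [LinearOrder γ] {y : β → γ → A} {z : α → γ → A}
    (hx : IsQuantumMatrix q x) (hy : IsQuantumMatrix q y)
    (hxy : ∀ i a c j, Commute (x i a) (y c j))
    (hz : ∀ j l, ∃ s : Finset β, ∀ i,
      z i j = ∑ a ∈ s, x i a * y a j ∧ z i l = ∑ a ∈ s, x i a * y a l) :
    IsQuantumMatrix q z := by
  intro i r j l
  obtain ⟨s, hs⟩ := hz j l
  have hmul (i r : α) (j l : γ) : (∑ a ∈ s, x i a * y a j) * ∑ c ∈ s, x r c * y c l =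
      ∑ a ∈ s, ∑ c ∈ s, x i a * x r c * (y a j * y c l) :=
    sum_mul_sum_of_commute s i r fun i a c => hxy i a c j
  rw [(hs i).1, (hs i).2, (hs r).1, (hs r).2, hmul, hmul, hmul,
    hx.sum_braid s i r fun a c => y a j * y c l]
  simp only [hy _ _ j l, mul_add, mul_smul_comm, Finset.sum_add_distrib, Finset.smul_sum]

lemma of_blocks {γ : Type*} [LinearOrder γ] {x : β → β → A} {b : β → γ} (hb : Monotone b)
    (hzero : ∀ i j, b i ≠ b j → x i j = 0)
    (hcomm : ∀ i r j l, b i ≠ b r → Commute (x i j) (x r l))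
    (hblock : ∀ i r j l, b i = b r → b i = b j → b i = b l →
      x r j * x i l + braidCoeff q i r • (x i j * x r l) =
        x i l * x r j + braidCoeff q j l • (x i j * x r l)) :
    IsQuantumMatrix q x := by
  intro i r j l
  by_cases hir : b i = b r
  · by_cases hij : b i = b j
    · by_cases hil : b i = b l
      · exact hblock i r j l hir hij hil
      · simp [hzero i l hil, hzero r l (hir ▸ hil)]
    · simp [hzero i j hij, hzero r j (hir ▸ hij)]
  · rw [(hcomm i r l j hir).eq]
    by_cases hij : b i = b j
    · by_cases hrl : b r = b l
      · have hcoeff : braidCoeff q i r = braidCoeff q j l := by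
          obtain h | h := lt_or_gt_of_ne hir
          · rw [braidCoeff_of_lt (hb.reflect_lt h),
              braidCoeff_of_lt (hb.reflect_lt (hij ▸ hrl ▸ h))]
          · rw [braidCoeff_of_gt (hb.reflect_lt h),
              braidCoeff_of_gt (hb.reflect_lt (hij ▸ hrl ▸ h))]
        rw [hcoeff]
      · simp [hzero r l hrl]
    · simp [hzero i j hij]

end IsQuantumMatrix

lemma IsQuantumExterior.map {e : β → A} (he : IsQuantumExterior q e) (φ : A →ₐ[k] B) :
    IsQuantumExterior q fun j => φ (e j) where
  sq j := by rw [← map_mul, he.sq, map_zero]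
  anti h := by rw [← map_mul, he.anti h, map_smul, map_mul]

lemma IsQuantumExterior.add_braidCoeff_smul {e : β → A} (he : IsQuantumExterior q e) (hq : q ≠ 0)
    (j l : β) : e l * e j + braidCoeff q j l • (e j * e l) = (-q⁻¹) • (e j * e l) := by
  obtain hjl | rfl | hlj := lt_trichotomy j l
  · rw [he.anti hjl, braidCoeff_of_lt hjl]
    module
  · simp only [he.sq, smul_zero, add_zero]
  · rw [he.anti hlj, braidCoeff_of_gt hlj]
    match_scalars
    field_simp
    ring

lemma IsBraidedPair.map {e f : β → A} (h : IsBraidedPair q e f) (φ : A →ₐ[k] B) :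
    IsBraidedPair q (fun j => φ (e j)) fun j => φ (f j) where
  left := h.left.map φ
  right := h.right.map φ
  braid j l := by simp only [← map_mul, ← map_smul, ← map_add, h.braid j l]

section Coaction

variable [Fintype β] {x : α → β → A} {e f : β → A}

lemma sum_sum_eq_zero_of_antisymm {M : Type*} [AddCommGroup M] {g : β → β → M}
    (hdiag : ∀ j, g j j = 0) (hanti : ∀ j l, j < l → g j l + g l j = 0) :
    ∑ j, ∑ l, g j l = 0 := by
  rw [← Fintype.sum_prod_type']
  refine Finset.sum_involution (fun p _ => p.swap) (fun p _ => ?_) (fun p _ hp hswap => ?_)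
    (fun p _ => Finset.mem_univ _) (fun p _ => p.swap_swap)
  · obtain h | h | h := lt_trichotomy p.1 p.2
    · exact hanti _ _ h
    · simp [h, hdiag]
    · rw [add_comm]
      exact hanti _ _ h
  · rw [← congrArg Prod.snd hswap] at hp
    exact hp (hdiag p.1)

lemma IsQuantumExterior.coact (hq : q ≠ 0) (he : IsQuantumExterior q e)
    (hx : IsQuantumMatrix q x) (hxe : ∀ i j l, Commute (x i j) (e l)) :
    IsQuantumExterior q fun i => ∑ j, x i j * e j where
  sq i := by
    rw [sum_mul_sum_of_commute _ i i hxe]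
    refine sum_sum_eq_zero_of_antisymm (fun j => by rw [he.sq, mul_zero]) fun j l hjl => ?_
    rw [hx.row i hjl, he.anti hjl, smul_mul_assoc, mul_smul_comm]
    module
  anti {i r} hir := by
    have h := hx.sum_braid Finset.univ i r fun j l => e j * e l
    simp only [he.add_braidCoeff_smul hq, mul_smul_comm, ← Finset.smul_sum] at h
    rw [← sum_mul_sum_of_commute _ r i hxe, ← sum_mul_sum_of_commute _ i r hxe,
      braidCoeff_of_lt hir, ← eq_sub_iff_add_eq] at h
    rw [h]
    module

lemma IsBraidedPair.coact (hq : q ≠ 0) (h : IsBraidedPair q e f) (hx : IsQuantumMatrix q x)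
    (hxe : ∀ i j l, Commute (x i j) (e l)) (hxf : ∀ i j l, Commute (x i j) (f l)) :
    IsBraidedPair q (fun i => ∑ j, x i j * e j) fun i => ∑ j, x i j * f j where
  left := h.left.coact hq hx hxe
  right := h.right.coact hq hx hxf
  braid i r := by
    rw [sum_mul_sum_of_commute _ i r hxe, sum_mul_sum_of_commute _ r i hxf,
      sum_mul_sum_of_commute _ i r hxf, hx.sum_braid Finset.univ i r fun j l => f j * e l]
    simp only [h.braid]

end Coaction

end Relations

/-! ### The algebra of quantum matrices -/

namespace QMat

variable {k : Type*} [Field k] {q : k} {m n : ℕ}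

lemma isQuantumMatrix (hq : q ≠ 0) : IsQuantumMatrix q (X q (m := m) (n := n)) := by
  let π : FreeAlgebra k (Fin m × Fin n) →ₐ[k] QMat q m n := RingQuot.mkAlgHom k (QMatRel q m n)
  have hX i j : X q i j = π (FreeAlgebra.ι k (i, j)) := rfl
  have hπ {a b} (h : QMatRel q m n a b) : π a = π b := RingQuot.mkAlgHom_rel k h
  refine .of_relations hq (fun i j l h => ?_) (fun {i r} h j => ?_) (fun {i r} h {j l} h' => ?_)
    (fun {i r} h {j l} h' => ?_)
  · simpa only [hX, map_mul, map_smul] using hπ (.row i j l h)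
  · simpa only [hX, map_mul, map_smul] using hπ (.col i r j h)
  · simpa only [hX, map_mul] using hπ (.anti i r j l h h')
  · simpa only [hX, map_sub, map_mul, map_smul] using hπ (.diag i r j l h h')

lemma exists_lift {A : Type*} [Ring A] [Algebra k A] {x : Fin m → Fin n → A}
    (hx : IsQuantumMatrix q x) : ∃ φ : QMat q m n →ₐ[k] A, ∀ i j, φ (X q i j) = x i j := by
  have hrel : ∀ ⦃a b⦄, QMatRel q m n a b →
      FreeAlgebra.lift k (fun p : Fin m × Fin n => x p.1 p.2) a =
      FreeAlgebra.lift k (fun p : Fin m × Fin n => x p.1 p.2) b := by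
    rintro a b (⟨i, j, l, h⟩ | ⟨i, r, j, h⟩ | ⟨i, r, j, l, h, h'⟩ | ⟨i, r, j, l, h, h'⟩) <;>
      simp only [map_sub, map_mul, map_smul, FreeAlgebra.lift_ι_apply]
    · exact hx.row i h
    · exact hx.col h j
    · exact hx.anti h h'
    · exact hx.diag h h'
  refine ⟨RingQuot.liftAlgHom k ⟨FreeAlgebra.lift k fun p => x p.1 p.2, hrel⟩, fun i j => ?_⟩
  exact (RingQuot.liftAlgHom_mkAlgHom_apply _ _ hrel _).trans (FreeAlgebra.lift_ι_apply _ _)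

lemma adjoin_range_X :
    Algebra.adjoin k (Set.range fun p : Fin m × Fin n => X q p.1 p.2) = ⊤ := by
  let π : FreeAlgebra k (Fin m × Fin n) →ₐ[k] QMat q m n := RingQuot.mkAlgHom k (QMatRel q m n)
  have hrange : (Set.range fun p : Fin m × Fin n => X q p.1 p.2) =
      π '' Set.range (FreeAlgebra.ι k) := by
    rw [← Set.range_comp]
    rfl
  rw [hrange, ← AlgHom.map_adjoin, FreeAlgebra.adjoin_range_ι, Algebra.map_top]
  exact (AlgHom.range_eq_top π).2 (RingQuot.mkAlgHom_surjective k _)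

lemma weightedQuasiCommutes (hq : q ≠ 0) :
    WeightedQuasiCommutes k (fun p : Fin m × Fin n => X q p.1 p.2) (fun p => (p.1 * p.2 : ℕ)) := by
  have hx := isQuantumMatrix (m := m) (n := n) hq
  have hlt {i r j l : ℕ} (h : i < r) (h' : j < l) : r * j + i * l < i * j + r * l := by
    nlinarith [mul_pos (Nat.sub_pos_of_lt h) (Nat.sub_pos_of_lt h'), Nat.sub_add_cancel h.le,
      Nat.sub_add_cancel h'.le]
  rintro ⟨i, j⟩ ⟨r, l⟩
  obtain h | rfl | h := lt_trichotomy i r <;> obtain h' | rfl | h' := lt_trichotomy j l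
  · refine ⟨1, one_ne_zero, ?_⟩
    rw [one_smul, hx.diag h h', hx.anti h h']
    exact Submodule.smul_mem _ _ (Submodule.subset_span ⟨(r, j), (i, l), hlt h h', rfl⟩)
  · exact ⟨q, hq, by simp [hx.col h]⟩
  · exact ⟨1, one_ne_zero, by simp [hx.anti h h']⟩
  · exact ⟨q, hq, by simp [hx.row _ h']⟩
  · exact ⟨1, one_ne_zero, by simp⟩
  · exact ⟨q⁻¹, inv_ne_zero hq, by simp [hx.row _ h', hq]⟩
  · exact ⟨1, one_ne_zero, by simp [hx.anti h h']⟩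
  · exact ⟨q⁻¹, inv_ne_zero hq, by simp [hx.col h, hq]⟩
  · refine ⟨1, one_ne_zero, ?_⟩
    rw [one_smul, ← neg_sub, hx.diag h h', hx.anti h h', neg_mem_iff]
    refine Submodule.smul_mem _ _ (Submodule.subset_span ⟨(i, l), (r, j), ?_, rfl⟩)
    linarith [hlt h h']

end QMat

/-! ### The path model of quantum matrices -/

section PathModel

variable {k A : Type*} [Field k] [Ring A] [Algebra k A] {q : k}

/-- The action of a `2 × 2` matrix `b` with entries in `A` on the columns `t` and `t + 1`. -/
def mixColumns {A α : Type*} [Ring A] (t : ℕ) (b : Fin 2 → Fin 2 → A) (x : α → ℕ → A)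
    (i : α) (j : ℕ) : A :=
  if j = t then b 0 0 * x i t + b 1 0 * x i (t + 1)
  else if j = t + 1 then b 0 1 * x i t + b 1 1 * x i (t + 1)
  else x i j

/-- The identity matrix with the `2 × 2` matrix `b` put at the indices `t` and `t + 1`. -/
def boxMatrix {A : Type*} [Ring A] (t : ℕ) (b : Fin 2 → Fin 2 → A) : ℕ → ℕ → A :=
  mixColumns t b fun i j => if i = j then 1 else 0

/-- The block sum of the `1 × 1` matrix `1` and the matrix `x`. -/
def oneBlockSum {A : Type*} [Ring A] (x : ℕ → ℕ → A) : ℕ → ℕ → A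
  | 0, 0 => 1
  | 0, _ + 1 => 0
  | _ + 1, 0 => 0
  | i + 1, j + 1 => x i j

/-- The block sum of `1` and `x`, with the boxes `b 0, …, b (t - 1)` applied to its columns. -/
def insertRow {A : Type*} [Ring A] (x : ℕ → ℕ → A) (b : ℕ → Fin 2 → Fin 2 → A) :
    ℕ → ℕ → ℕ → A
  | 0 => oneBlockSum x
  | t + 1 => mixColumns t (b t) (insertRow x b t)

/-- The matrix with `m` nonzero rows built from the boxes `b (s', t)` with `s ≤ s' < s + m` and
`t < n`. Its entry `(i, j)` is the sum over the lattice paths from row `i` to column `j` of the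
products of the entries of boxes met along the path. -/
def pathMatrix {A : Type*} [Ring A] (n : ℕ) (b : ℕ × ℕ → Fin 2 → Fin 2 → A) :
    ℕ → ℕ → ℕ → ℕ → A
  | 0, _ => fun _ _ => 0
  | m + 1, s => insertRow (pathMatrix n b m (s + 1)) (fun t => b (s, t)) n

section Commute

variable {A : Type*} [Ring A] {T : A}

lemma commute_mixColumns {α : Type*} {x : α → ℕ → A} {t : ℕ} {b : Fin 2 → Fin 2 → A}
    (hx : ∀ i j, Commute T (x i j)) (hb : ∀ a c, Commute T (b a c)) (i : α) (j : ℕ) :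
    Commute T (mixColumns t b x i j) := by
  unfold mixColumns
  split_ifs
  · exact ((hb _ _).mul_right (hx _ _)).add_right ((hb _ _).mul_right (hx _ _))
  · exact ((hb _ _).mul_right (hx _ _)).add_right ((hb _ _).mul_right (hx _ _))
  · exact hx i j

lemma commute_insertRow {x : ℕ → ℕ → A} {b : ℕ → Fin 2 → Fin 2 → A} {t : ℕ}
    (hx : ∀ i j, Commute T (x i j)) (hb : ∀ s < t, ∀ a c, Commute T (b s a c)) (i j : ℕ) :
    Commute T (insertRow x b t i j) := by
  induction t generalizing i j with
  | zero => cases i <;> cases j <;> simp [insertRow, oneBlockSum, hx]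
  | succ t ih =>
    exact commute_mixColumns (ih fun s hs => hb s (hs.trans t.lt_succ_self))
      (hb t t.lt_succ_self) i j

lemma commute_pathMatrix {n : ℕ} {b : ℕ × ℕ → Fin 2 → Fin 2 → A} {m s : ℕ}
    (hb : ∀ p : ℕ × ℕ, s ≤ p.1 → ∀ a c, Commute T (b p a c)) (i j : ℕ) :
    Commute T (pathMatrix n b m s i j) := by
  induction m generalizing s i j with
  | zero => exact Commute.zero_right T
  | succ m ih =>
    exact commute_insertRow (ih fun p hp => hb p (Nat.le_of_succ_le hp))
      (fun t _ => hb (s, t) le_rfl) i j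

end Commute

lemma mixColumns_self {α : Type*} (t : ℕ) (b : Fin 2 → Fin 2 → A) (x : α → ℕ → A) (i : α) :
    mixColumns t b x i t = b 0 0 * x i t + b 1 0 * x i (t + 1) :=
  if_pos rfl

lemma mixColumns_succ {α : Type*} (t : ℕ) (b : Fin 2 → Fin 2 → A) (x : α → ℕ → A) (i : α) :
    mixColumns t b x i (t + 1) = b 0 1 * x i t + b 1 1 * x i (t + 1) := by
  simp [mixColumns]

lemma mixColumns_of_ne {α : Type*} {t j : ℕ} (hj : j ≠ t) (hj' : j ≠ t + 1)
    (b : Fin 2 → Fin 2 → A) (x : α → ℕ → A) (i : α) : mixColumns t b x i j = x i j := by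
  simp [mixColumns, hj, hj']

lemma mixColumns_eq_sum {α : Type*} {t j : ℕ} {s : Finset ℕ} (hj : j ∈ s) (ht : t ∈ s)
    (ht' : t + 1 ∈ s) (b : Fin 2 → Fin 2 → A) (x : α → ℕ → A) (i : α)
    (hxb : ∀ j a c, Commute (x i j) (b a c)) :
    mixColumns t b x i j = ∑ a ∈ s, x i a * boxMatrix t b a j := by
  have hsum (y : A) {l : ℕ} (hl : l ∈ s) :
      ∑ a ∈ s, x i a * (y * if a = l then 1 else 0) = x i l * y := by
    simp [hl]
  obtain rfl | hjt := eq_or_ne j t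
  · simp only [boxMatrix, mixColumns_self, mul_add, Finset.sum_add_distrib, hsum _ hj,
      hsum _ ht', (hxb _ _ _).eq]
  obtain rfl | hjt' := eq_or_ne j (t + 1)
  · simp only [boxMatrix, mixColumns_succ, mul_add, Finset.sum_add_distrib, hsum _ hj,
      hsum _ ht, (hxb _ _ _).eq]
  · simp [boxMatrix, mixColumns_of_ne hjt hjt', hj]

lemma boxMatrix_add_add (t : ℕ) (b : Fin 2 → Fin 2 → A) (a c : Fin 2) :
    boxMatrix t b (t + a) (t + c) = b a c := by
  fin_cases a <;> fin_cases c <;> simp [boxMatrix, mixColumns]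

lemma boxMatrix_of_ne {t i : ℕ} (hi : i ≠ t) (hi' : i ≠ t + 1) (b : Fin 2 → Fin 2 → A) (j : ℕ) :
    boxMatrix t b i j = if i = j then 1 else 0 := by
  unfold boxMatrix mixColumns
  split_ifs <;> simp_all

lemma commute_boxMatrix_of_ne {t i : ℕ} (hi : i ≠ t) (hi' : i ≠ t + 1)
    (b : Fin 2 → Fin 2 → A) (j : ℕ) (y : A) : Commute (boxMatrix t b i j) y := by
  rw [boxMatrix_of_ne hi hi']
  split_ifs
  exacts [Commute.one_left y, Commute.zero_left y]

lemma isQuantumMatrix_boxMatrix (t : ℕ) {b : Fin 2 → Fin 2 → A} (hb : IsQuantumMatrix q b) :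
    IsQuantumMatrix q (boxMatrix t b) := by
  let block (i : ℕ) : ℕ := if i ≤ t then i else i - 1
  have hblock {i : ℕ} (h : block i = t) : ∃ a : Fin 2, i = t + a := by
    obtain rfl | rfl : i = t ∨ i = t + 1 := by
      simp only [block] at h
      split_ifs at h <;> omega
    exacts [⟨0, rfl⟩, ⟨1, rfl⟩]
  have hne {i : ℕ} (h : block i ≠ t) : i ≠ t ∧ i ≠ t + 1 := by
    simp only [block] at h
    split_ifs at h <;> omega
  have heq {i j : ℕ} (h : block i ≠ t) (hij : block i = block j) : i = j := by
    simp only [block] at h hij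
    split_ifs at h hij <;> omega
  have hadd : StrictMono fun a : Fin 2 => t + (a : ℕ) := fun _ _ h => Nat.add_lt_add_left h t
  refine .of_blocks (b := block) (fun i j hij => ?_) (fun i j hij => ?_) (fun i r j l hir => ?_)
    fun i r j l hir hij hil => ?_
  · simp only [block]
    split_ifs <;> omega
  · by_cases hi : block i = t
    · have hj := hne (hi ▸ hij.symm)
      have hij' : i ≠ j := fun h => hij (h ▸ rfl)
      obtain ⟨a, rfl⟩ := hblock hi
      simp [boxMatrix, mixColumns_of_ne hj.1 hj.2, hij']
    · rw [boxMatrix_of_ne (hne hi).1 (hne hi).2, if_neg fun h => hij (congrArg block h)]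
  · by_cases hi : block i = t
    · have hr := hne (hi ▸ hir.symm)
      exact (commute_boxMatrix_of_ne hr.1 hr.2 b l _).symm
    · exact commute_boxMatrix_of_ne (hne hi).1 (hne hi).2 b j _
  · by_cases hi : block i = t
    · obtain ⟨a, rfl⟩ := hblock hi
      obtain ⟨a', rfl⟩ := hblock (hir ▸ hi)
      obtain ⟨c, rfl⟩ := hblock (hij ▸ hi)
      obtain ⟨c', rfl⟩ := hblock (hil ▸ hi)
      simpa only [boxMatrix_add_add, braidCoeff_apply_of_strictMono hadd] using hb a a' c c'
    · obtain rfl := heq hi hir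
      obtain rfl := heq hi hij
      obtain rfl := heq hi hil
      rfl

lemma isQuantumMatrix_mixColumns {α : Type*} [LinearOrder α] {x : α → ℕ → A}
    (hx : IsQuantumMatrix q x) (t : ℕ) {b : Fin 2 → Fin 2 → A} (hb : IsQuantumMatrix q b)
    (hxb : ∀ i j a c, Commute (x i j) (b a c)) : IsQuantumMatrix q (mixColumns t b x) := by
  refine hx.of_eq_sum_mul (isQuantumMatrix_boxMatrix t hb) (fun i a c j => ?_) fun j l =>
    ⟨{t, t + 1, j, l}, fun i => ⟨mixColumns_eq_sum ?_ ?_ ?_ b x i (hxb i),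
      mixColumns_eq_sum ?_ ?_ ?_ b x i (hxb i)⟩⟩
  any_goals simp
  refine commute_mixColumns (fun i j => ?_) (hxb _ _) c j
  split_ifs
  exacts [Commute.one_right _, Commute.zero_right _]

lemma isQuantumMatrix_oneBlockSum {x : ℕ → ℕ → A} (hx : IsQuantumMatrix q x) :
    IsQuantumMatrix q (oneBlockSum x) := by
  have hsucc : StrictMono Nat.succ := fun _ _ => Nat.succ_lt_succ
  rintro (_ | i) (_ | r) (_ | j) (_ | l)
  case succ.succ.succ.succ =>
    simpa only [oneBlockSum, Nat.succ_eq_add_one, braidCoeff_apply_of_strictMono hsucc]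
      using hx i r j l
  all_goals simp [oneBlockSum, braidCoeff]

lemma isQuantumMatrix_insertRow {x : ℕ → ℕ → A} {b : ℕ → Fin 2 → Fin 2 → A}
    (hx : IsQuantumMatrix q x) (hb : ∀ t, IsQuantumMatrix q (b t))
    (hxb : ∀ i j t a c, Commute (x i j) (b t a c))
    (hbb : ∀ s t, s ≠ t → ∀ a a' c c', Commute (b s a c) (b t a' c')) (t : ℕ) :
    IsQuantumMatrix q (insertRow x b t) := by
  induction t with
  | zero => exact isQuantumMatrix_oneBlockSum hx
  | succ t ih =>
    exact isQuantumMatrix_mixColumns ih t (hb t) fun i j a c => (commute_insertRow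
      (fun i j => (hxb i j t a c).symm) (fun s hs a' c' => hbb t s hs.ne' a a' c c') i j).symm

lemma isQuantumMatrix_pathMatrix {b : ℕ × ℕ → Fin 2 → Fin 2 → A}
    (hb : ∀ p, IsQuantumMatrix q (b p))
    (hbb : ∀ p p', p ≠ p' → ∀ a a' c c', Commute (b p a c) (b p' a' c')) (n m s : ℕ) :
    IsQuantumMatrix q (pathMatrix n b m s) := by
  induction m generalizing s with
  | zero => simp [IsQuantumMatrix, pathMatrix]
  | succ m ih =>
    refine isQuantumMatrix_insertRow (ih (s + 1)) (fun t => hb (s, t)) (fun i j t a c => ?_)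
      (fun t t' h => hbb _ _ (by simpa using h)) n
    refine (commute_pathMatrix (fun p hp a' c' => hbb _ _ ?_ a a' c c') i j).symm
    rintro rfl
    exact Nat.not_succ_le_self s hp

section InsertRow

variable {V : Type*} [AddCommGroup V] [Module k V] {x : ℕ → ℕ → Module.End k V}
  {b : ℕ → Fin 2 → Fin 2 → Module.End k V} {v : V}

lemma insertRow_zero_apply (hv : ∀ t, ∃ c : k, c ≠ 0 ∧ b t 0 1 v = c • v) (t : ℕ) :
    (∀ j < t, ∃ c : k, c ≠ 0 ∧ insertRow x b t 0 j v = c • b j 0 0 v) ∧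
      (∃ c : k, c ≠ 0 ∧ insertRow x b t 0 t v = c • v) ∧
      ∀ j > t, insertRow x b t 0 j v = 0 := by
  induction t with
  | zero =>
    refine ⟨by simp, ⟨1, one_ne_zero, by simp [insertRow, oneBlockSum]⟩, fun j hj => ?_⟩
    obtain ⟨j, rfl⟩ := Nat.exists_eq_succ_of_ne_zero hj.ne'
    simp [insertRow, oneBlockSum]
  | succ t ih =>
    obtain ⟨ihlt, ⟨c, hc, iht⟩, ihgt⟩ := ih
    refine ⟨fun j hj => ?_, ?_, fun j hj => ?_⟩
    · obtain hj | rfl := Nat.lt_succ_iff_lt_or_eq.1 hj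
      · simpa only [insertRow, mixColumns_of_ne hj.ne (hj.trans t.lt_succ_self).ne]
          using ihlt j hj
      · exact ⟨c, hc, by simp [insertRow, mixColumns_self, iht, ihgt]⟩
    · obtain ⟨d, hd, hv⟩ := hv t
      exact ⟨c * d, mul_ne_zero hc hd,
        by simp [insertRow, mixColumns_succ, iht, ihgt, hv, mul_smul]⟩
    · rw [insertRow, mixColumns_of_ne (t.lt_succ_self.trans hj).ne' hj.ne',
        ihgt j (t.lt_succ_self.trans hj)]

lemma insertRow_succ_apply (hxb : ∀ i j t a c, Commute (x i j) (b t a c))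
    (hv : ∀ t, b t 1 0 v = v) (hv' : ∀ t, b t 1 1 v = 0) (r t : ℕ) :
    (∀ j < t, insertRow x b t (r + 1) j v = x r j v) ∧
      insertRow x b t (r + 1) t v = 0 ∧
      ∀ j ≥ t, insertRow x b t (r + 1) (j + 1) v = x r j v := by
  have hxb' (t a c j) : b t a c (x r j v) = x r j (b t a c v) :=
    LinearMap.congr_fun (hxb r j t a c).symm.eq v
  induction t with
  | zero => simp [insertRow, oneBlockSum]
  | succ t ih =>
    obtain ⟨ihlt, iht, ihgt⟩ := ih
    refine ⟨fun j hj => ?_, ?_, fun j hj => ?_⟩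
    · obtain hj | rfl := Nat.lt_succ_iff_lt_or_eq.1 hj
      · simpa only [insertRow, mixColumns_of_ne hj.ne (hj.trans t.lt_succ_self).ne]
          using ihlt j hj
      · simp [insertRow, mixColumns_self, iht, ihgt, hxb', hv]
    · simp [insertRow, mixColumns_succ, iht, ihgt, hxb', hv']
    · have hj' : t < j := hj
      rw [insertRow, mixColumns_of_ne (by lia) (by lia), ihgt j hj'.le]

end InsertRow

end PathModel

section Oscillator

variable {k ι : Type*} [Field k] {q : k} {p p' : ι}

/-- The operator on the span of the occupation numbers `s : ι →₀ ℕ` which replaces the number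
`a` at the site `p` by `f a`, with the coefficient `c a`. -/
noncomputable def siteOp (p : ι) (c : ℕ → k) (f : ℕ → ℕ) : Module.End k ((ι →₀ ℕ) →₀ k) :=
  Finsupp.linearCombination k fun s => Finsupp.single (s.update p (f (s p))) (c (s p))

/-- The `2 × 2` quantum matrix of the `q`-oscillator at the site `p`: creation and annihilation
operators on the diagonal, and the operator `q ^ (-a)` off it. -/
noncomputable def oscillatorBox (q : k) (p : ι) (i j : Fin 2) : Module.End k ((ι →₀ ℕ) →₀ k) :=
  siteOp p
    (!![1, fun a => (q ^ a)⁻¹; fun a => (q ^ a)⁻¹, fun a => q * ((q ^ a)⁻¹ ^ 2 - 1)] i j)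
    (!![Nat.succ, id; id, Nat.pred] i j)

lemma siteOp_single (c : ℕ → k) (f : ℕ → ℕ) (s : ι →₀ ℕ) :
    siteOp p c f (Finsupp.single s 1) = c (s p) • Finsupp.single (s.update p (f (s p))) 1 := by
  simp only [siteOp, Finsupp.linearCombination_single, one_smul, Finsupp.smul_single_one]

lemma siteOp_id_single (c : ℕ → k) (s : ι →₀ ℕ) :
    siteOp p c id (Finsupp.single s 1) = c (s p) • Finsupp.single s 1 := by
  rw [siteOp_single, id, Finsupp.update_self]

lemma siteOp_mul (c d : ℕ → k) (f g : ℕ → ℕ) :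
    siteOp p c f * siteOp p d g = siteOp p (fun a => d a * c (g a)) (f ∘ g) := by
  classical
  refine Finsupp.basisSingleOne.ext fun s => ?_
  simp only [Finsupp.coe_basisSingleOne, Module.End.mul_apply, siteOp_single, map_smul, smul_smul,
    Finsupp.update_apply, if_true, Finsupp.update_idem, Function.comp_apply]

lemma smul_siteOp (a : k) (c : ℕ → k) (f : ℕ → ℕ) :
    a • siteOp p c f = siteOp p (fun n => a * c n) f := by
  refine Finsupp.basisSingleOne.ext fun s => ?_
  simp only [Finsupp.coe_basisSingleOne, LinearMap.smul_apply, siteOp_single, smul_smul]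

lemma siteOp_sub (c d : ℕ → k) (f : ℕ → ℕ) :
    siteOp p c f - siteOp p d f = siteOp p (fun n => c n - d n) f := by
  refine Finsupp.basisSingleOne.ext fun s => ?_
  simp only [Finsupp.coe_basisSingleOne, LinearMap.sub_apply, siteOp_single, sub_smul]

lemma commute_siteOp (h : p ≠ p') (c d : ℕ → k) (f g : ℕ → ℕ) :
    Commute (siteOp p c f) (siteOp p' d g) := by
  classical
  refine Finsupp.basisSingleOne.ext fun s => ?_
  simp only [Finsupp.coe_basisSingleOne, Module.End.mul_apply, siteOp_single, map_smul, smul_smul,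
    Finsupp.update_apply, h, h.symm, if_false, Finsupp.update_comm s h]
  rw [mul_comm]

lemma commute_oscillatorBox (h : p ≠ p') (a a' c c' : Fin 2) :
    Commute (oscillatorBox q p a c) (oscillatorBox q p' a' c') :=
  commute_siteOp h _ _ _ _

lemma siteOp_congr {c d : ℕ → k} {f g : ℕ → ℕ} (hcd : ∀ a, c a = d a)
    (hfg : ∀ a, d a ≠ 0 → f a = g a) : siteOp p c f = siteOp p d g := by
  refine Finsupp.basisSingleOne.ext fun s => ?_
  simp only [Finsupp.coe_basisSingleOne, siteOp_single, hcd]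
  by_cases hd : d (s p) = 0
  · rw [hd, zero_smul, zero_smul]
  · rw [hfg _ hd]

lemma oscillatorBox_row_zero (hq : q ≠ 0) (p : ι) :
    oscillatorBox q p 0 0 * oscillatorBox q p 0 1 =
      q • (oscillatorBox q p 0 1 * oscillatorBox q p 0 0) := by
  simp only [oscillatorBox, siteOp_mul, smul_siteOp]
  refine siteOp_congr (fun a => ?_) fun _ _ => rfl
  simp [pow_succ, hq]

lemma oscillatorBox_row_one (hq : q ≠ 0) (p : ι) :
    oscillatorBox q p 1 0 * oscillatorBox q p 1 1 =
      q • (oscillatorBox q p 1 1 * oscillatorBox q p 1 0) := by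
  simp only [oscillatorBox, siteOp_mul, smul_siteOp]
  refine siteOp_congr (fun a => ?_) fun _ _ => rfl
  cases a with
  | zero => simp
  | succ a =>
    simp only [Matrix.of_apply, Matrix.cons_val, Nat.pred_succ, id]
    field_simp
    ring

lemma oscillatorBox_diag (hq : q ≠ 0) (p : ι) :
    oscillatorBox q p 0 0 * oscillatorBox q p 1 1 -
        oscillatorBox q p 1 1 * oscillatorBox q p 0 0 =
      (q - q⁻¹) • (oscillatorBox q p 0 1 * oscillatorBox q p 1 0) := by
  have hcreate : oscillatorBox q p 0 0 * oscillatorBox q p 1 1 =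
      siteOp p (fun a => q * ((q ^ a)⁻¹ ^ 2 - 1)) id := by
    simp only [oscillatorBox, siteOp_mul]
    refine siteOp_congr (fun a => by simp) fun a ha => Nat.succ_pred_eq_of_ne_zero ?_
    rintro rfl
    simp at ha
  have hannihilate : oscillatorBox q p 1 1 * oscillatorBox q p 0 0 =
      siteOp p (fun a => q * ((q ^ (a + 1))⁻¹ ^ 2 - 1)) id := by
    simp only [oscillatorBox, siteOp_mul]
    exact siteOp_congr (fun a => by simp) fun a _ => rfl
  rw [hcreate, hannihilate, siteOp_sub]
  simp only [oscillatorBox, siteOp_mul, smul_siteOp]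
  refine siteOp_congr (fun a => ?_) fun _ _ => rfl
  simp only [Matrix.of_apply, Matrix.cons_val, id]
  field_simp
  ring

lemma isQuantumMatrix_oscillatorBox (hq : q ≠ 0) (p : ι) :
    IsQuantumMatrix q (oscillatorBox q p) := by
  have hlt {i j : Fin 2} (h : i < j) : i = 0 ∧ j = 1 := by lia
  refine .of_relations hq (fun i j l h => ?_) (fun {i r} h j => ?_) (fun {i r} h {j l} h' => ?_)
    (fun {i r} h {j l} h' => ?_)
  · obtain ⟨rfl, rfl⟩ := hlt h
    fin_cases i
    exacts [oscillatorBox_row_zero hq p, oscillatorBox_row_one hq p]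
  · obtain ⟨rfl, rfl⟩ := hlt h
    fin_cases j
    exacts [oscillatorBox_row_zero hq p, oscillatorBox_row_one hq p]
  · obtain ⟨rfl, rfl⟩ := hlt h
    obtain ⟨rfl, rfl⟩ := hlt h'
    rfl
  · obtain ⟨rfl, rfl⟩ := hlt h
    obtain ⟨rfl, rfl⟩ := hlt h'
    exact oscillatorBox_diag hq p

lemma oscillatorBox_zero_zero_single (s : ι →₀ ℕ) :
    oscillatorBox q p 0 0 (Finsupp.single s 1) = Finsupp.single (s + Finsupp.single p 1) 1 := by
  classical
  have hupdate : s.update p (s p).succ = s + Finsupp.single p 1 := by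
    ext p'
    obtain rfl | h := eq_or_ne p' p <;> simp [Finsupp.update_apply, *]
  simp [oscillatorBox, siteOp_single, hupdate]

lemma pathMatrix_oscillatorBox_single (hq : q ≠ 0) {n m s i j : ℕ} (hi : i < m) (hj : j < n)
    {a : ℕ × ℕ →₀ ℕ} (ha : ∀ p : ℕ × ℕ, s ≤ p.1 → p.1 < s + i → a p = 0) :
    ∃ c : k, c ≠ 0 ∧ pathMatrix n (oscillatorBox q) m s i j (Finsupp.single a 1) =
      c • Finsupp.single (a + Finsupp.single (s + i, j) 1) 1 := by
  induction m generalizing s i with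
  | zero => exact absurd hi i.not_lt_zero
  | succ m ih =>
    rw [pathMatrix]
    cases i with
    | zero =>
      have hoff (t : ℕ) : ∃ c : k, c ≠ 0 ∧
          oscillatorBox q (s, t) 0 1 (Finsupp.single a 1) = c • Finsupp.single a 1 :=
        ⟨(q ^ a (s, t))⁻¹, by simp [hq], siteOp_id_single _ a⟩
      obtain ⟨c, hc, h⟩ := (insertRow_zero_apply hoff n).1 j hj
      exact ⟨c, hc, by rw [h, oscillatorBox_zero_zero_single, add_zero]⟩
    | succ i =>
      have hvacant (t : ℕ) : a (s, t) = 0 := ha _ le_rfl (by lia)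
      obtain ⟨c, hc, h⟩ := ih (s := s + 1) (Nat.lt_of_succ_lt_succ hi)
        fun p hp hp' => ha p (by lia) (by lia)
      refine ⟨c, hc, ?_⟩
      rw [(insertRow_succ_apply ?_ (fun t => ?_) (fun t => ?_) i n).1 j hj, h]
      · rw [add_right_comm, add_assoc]
      · refine fun i j t a' c' => (commute_pathMatrix (fun p hp b d => ?_) i j).symm
        refine commute_oscillatorBox ?_ _ _ _ _
        rintro rfl
        exact Nat.not_succ_le_self s hp
      · exact (siteOp_id_single _ a).trans (by simp [hvacant])
      · simp [oscillatorBox, siteOp_single, hvacant]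

end Oscillator

namespace QMat

variable {k : Type*} [Field k] {q : k} {m n : ℕ}

/-- The number of occurrences of each letter, for words in the letters `X i j`. -/
noncomputable def content (s : Multiset (Fin m × Fin n)) : ℕ × ℕ →₀ ℕ :=
  Multiset.toFinsupp (s.map (Prod.map Fin.val Fin.val))

lemma content_injective : Function.Injective (content (m := m) (n := n)) :=
  Multiset.toFinsupp.injective.comp
    (Multiset.map_injective (Fin.val_injective.prodMap Fin.val_injective))

lemma exists_action (hq : q ≠ 0) :
    ∃ φ : QMat q m n →ₐ[k] Module.End k ((ℕ × ℕ →₀ ℕ) →₀ k),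
      ∀ w : List (Fin m × Fin n), w.Pairwise (fun p p' => p.1 ≤ p'.1) →
        ∃ c : k, c ≠ 0 ∧ φ (wordProd (fun p => X q p.1 p.2) w) (Finsupp.single 0 1) =
          c • Finsupp.single (content (w : Multiset (Fin m × Fin n))) 1 := by
  obtain ⟨φ, hφ⟩ := exists_lift ((isQuantumMatrix_pathMatrix (isQuantumMatrix_oscillatorBox hq)
    (fun p p' h => commute_oscillatorBox h) n m 0).reindex
      (Fin.val_strictMono (n := m)) (Fin.val_strictMono (n := n)))
  refine ⟨φ, fun w hw => ?_⟩
  induction w with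
  | nil => exact ⟨1, one_ne_zero, by simp [content]⟩
  | cons p w ih =>
    rw [List.pairwise_cons] at hw
    obtain ⟨c, hc, h⟩ := ih hw.2
    have hvacant (p' : ℕ × ℕ) (hp' : p'.1 < 0 + p.1) :
        content (w : Multiset (Fin m × Fin n)) p' = 0 := by
      rw [content, Multiset.toFinsupp_apply, Multiset.count_eq_zero, Multiset.mem_map]
      rintro ⟨a, ha, rfl⟩
      exact (hw.1 a ha).not_gt (by simpa using hp')
    obtain ⟨d, hd, hp⟩ := pathMatrix_oscillatorBox_single hq p.1.2 p.2.2 fun p' _ => hvacant p'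
    refine ⟨c * d, mul_ne_zero hc hd, ?_⟩
    rw [wordProd_cons, map_mul, Module.End.mul_apply, h, map_smul, hφ, hp, smul_smul, zero_add,
      ← Multiset.cons_coe]
    simp [content, Prod.map, ← Multiset.singleton_add, add_comm]

theorem noZeroDivisors (hq : q ≠ 0) : NoZeroDivisors (QMat q m n) := by
  obtain ⟨φ, hφ⟩ := exists_action (m := m) (n := n) hq
  refine (weightedQuasiCommutes hq).noZeroDivisors adjoin_range_X content_injective
    (LinearMap.applyₗ (Finsupp.single 0 1) ∘ₗ φ.toLinearMap) fun s => ?_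
  let r (p p' : Fin m × Fin n) : Prop := p.1 ≤ p'.1
  have : Std.Total r := ⟨fun p p' => le_total p.1 p'.1⟩
  have : IsTrans _ r := ⟨fun _ _ _ => le_trans⟩
  induction s using Quotient.inductionOn with
  | h w =>
    obtain ⟨c, hc, h⟩ := hφ _ (w.pairwise_insertionSort r)
    have hperm := Multiset.coe_eq_coe.2 (w.perm_insertionSort r)
    exact ⟨w.insertionSort r, hperm, c, hc, by simpa [hperm] using h⟩

theorem isDomain (hq : q ≠ 0) : IsDomain (QMat q m n) := by
  obtain ⟨φ, -⟩ := exists_action (m := m) (n := n) hq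
  have := noZeroDivisors (m := m) (n := n) hq
  have : Nontrivial (QMat q m n) := φ.toRingHom.domain_nontrivial
  exact NoZeroDivisors.to_isDomain _

end QMat

/-! ### A braided pair with linearly independent ordered monomials -/

section BraidedPair

open TensorProduct

/-- The relations between the coefficients under which
`(1 ⊗ ε, e₁ ⊗ a, e₂ ⊗ a, …)` and `(1 ⊗ φ, f₁ ⊗ b + e₁ ⊗ c, f₂ ⊗ b + e₂ ⊗ c, …)` form a braided pair
whenever `(e₁, e₂, …)` and `(f₁, f₂, …)` do. -/
structure IsBraidedExtension {k M : Type*} [Field k] [Ring M] [Algebra k M] (q : k)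
    (ε φ a b c : M) : Prop where
  ε_mul_ε : ε * ε = 0
  φ_mul_φ : φ * φ = 0
  ε_mul_φ : ε * φ = q • (φ * ε)
  a_mul_ε : a * ε = (-q) • (ε * a)
  a_mul_φ : a * φ = φ * a
  b_mul_φ : b * φ = (-q) • (φ * b)
  c_mul_φ : c * φ = (-q) • (φ * c)
  ε_mul_b : ε * b = b * ε
  ε_mul_c : ε * c = c * ε + (q - q⁻¹) • (φ * a)
  a_mul_b : a * b = b * a
  a_mul_c : a * c = (-q⁻¹) • (c * a)
  b_mul_c : b * c = (-q) • (c * b)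

section Extension

variable {k E M : Type*} [Field k] [Ring E] [Algebra k E] [Ring M] [Algebra k M] {q : k} {n : ℕ}
variable {e f : Fin n → E} {ε φ a b c : M}

lemma IsQuantumExterior.cons_tmul (he : IsQuantumExterior q e) (hε : ε * ε = 0)
    (ha : a * ε = (-q) • (ε * a)) :
    IsQuantumExterior q
      (Fin.cons (1 ⊗ₜ ε) fun j => e j ⊗ₜ a : Fin (n + 1) → E ⊗[k] M) where
  sq j := by
    cases j using Fin.cases <;> simp [he.sq, hε]
  anti {j l} hjl := by
    cases l using Fin.cases with
    | zero => exact absurd hjl (Fin.not_lt_zero j)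
    | succ l =>
      cases j using Fin.cases with
      | zero => simp [ha, tmul_neg]
      | succ j => simp [he.anti (Fin.succ_lt_succ_iff.1 hjl), neg_tmul, smul_tmul']

namespace IsBraidedPair

lemma isQuantumExterior_cons_tmul (h : IsBraidedPair q e f) (hq : q ≠ 0)
    (hM : IsBraidedExtension q ε φ a b c) :
    IsQuantumExterior q
      (Fin.cons (1 ⊗ₜ φ) fun j => f j ⊗ₜ b + e j ⊗ₜ c : Fin (n + 1) → E ⊗[k] M) where
  sq j := by
    cases j using Fin.cases with
    | zero => simp [hM.φ_mul_φ]
    | succ j =>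
      simp only [Fin.cons_succ, add_mul, mul_add, Algebra.TensorProduct.tmul_mul_tmul,
        h.left.sq, h.right.sq, h.braid j j, braidCoeff_self, hM.b_mul_c, zero_tmul, add_tmul,
        tmul_smul, ← smul_tmul']
      module
  anti {j l} hjl := by
    cases l using Fin.cases with
    | zero => exact absurd hjl (Fin.not_lt_zero j)
    | succ l =>
      cases j using Fin.cases with
      | zero => simp [mul_add, add_mul, hM.b_mul_φ, hM.c_mul_φ, tmul_neg, add_comm]
      | succ j =>
        rw [Fin.succ_lt_succ_iff] at hjl
        simp only [Fin.cons_succ, add_mul, mul_add, Algebra.TensorProduct.tmul_mul_tmul,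
          h.left.anti hjl, h.right.anti hjl, h.braid j l, h.braid l j, braidCoeff_of_lt hjl,
          braidCoeff_of_gt hjl, hM.b_mul_c, add_tmul, tmul_smul, ← smul_tmul', zero_smul, add_zero]
        match_scalars <;> field_simp
        ring

lemma cons_tmul (h : IsBraidedPair q e f) (hq : q ≠ 0) (hM : IsBraidedExtension q ε φ a b c) :
    IsBraidedPair q (Fin.cons (1 ⊗ₜ ε) fun j => e j ⊗ₜ a : Fin (n + 1) → E ⊗[k] M)
      (Fin.cons (1 ⊗ₜ φ) fun j => f j ⊗ₜ b + e j ⊗ₜ c) where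
  left := h.left.cons_tmul hM.ε_mul_ε hM.a_mul_ε
  right := h.isQuantumExterior_cons_tmul hq hM
  braid j l := by
    cases j using Fin.cases with
    | zero =>
      cases l using Fin.cases with
      | zero =>
        simp [hM.ε_mul_φ, sub_smul]
      | succ l =>
        simp only [Fin.cons_zero, Fin.cons_succ, add_mul, mul_add, one_mul, mul_one,
          Algebra.TensorProduct.tmul_mul_tmul, braidCoeff_of_lt (Fin.succ_pos l), hM.ε_mul_b,
          hM.ε_mul_c, tmul_add, tmul_smul]
        abel
    | succ j =>
      cases l using Fin.cases with
      | zero => simp [braidCoeff_of_gt (Fin.succ_pos j), hM.a_mul_φ]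
      | succ l =>
        have hee := congrArg (· ⊗ₜ[k] (c * a)) (h.left.add_braidCoeff_smul hq j l)
        simp only [add_tmul, ← smul_tmul'] at hee
        simp only [Fin.cons_succ, add_mul, mul_add, Algebra.TensorProduct.tmul_mul_tmul,
          braidCoeff_apply_of_strictMono (Fin.strictMono_succ), h.braid j l, hM.a_mul_b,
          hM.a_mul_c, add_tmul, tmul_smul, ← smul_tmul', ← hee]
        module

end IsBraidedPair

/-- The word obtained from `u` by shifting the letters and prepending `0` if `b` holds. -/
def shiftWord (b : Bool) (u : List (Fin n)) : List (Fin (n + 1)) :=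
  List.replicate b.toNat 0 ++ u.map Fin.succ

lemma shiftWord_inj {b b' : Bool} {u u' : List (Fin n)} :
    shiftWord b u = shiftWord b' u' ↔ b = b' ∧ u = u' := by
  have hinj : Function.Injective (List.map (Fin.succ (n := n))) :=
    List.map_injective_iff.2 (Fin.succ_injective n)
  have hne (w w' : List (Fin n)) : 0 :: w.map Fin.succ ≠ w'.map Fin.succ := fun h => by
    have hmem : (0 : Fin (n + 1)) ∈ w'.map Fin.succ := h ▸ List.mem_cons_self
    simp at hmem
  cases b <;> cases b' <;> simp [shiftWord, hinj.eq_iff, hne, (hne _ _).symm]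

lemma exists_map_succ_eq {u : List (Fin (n + 1))} (hu : u.Pairwise (· < ·))
    (hpos : ∀ j ∈ u, 0 < j) : ∃ u' : List (Fin n), u'.Pairwise (· < ·) ∧ u'.map Fin.succ = u := by
  have hrange : u ∈ Set.range (List.map (Fin.succ (n := n))) := by
    rw [Set.range_list_map]
    exact fun j hj => Fin.exists_succ_eq.2 (hpos j hj).ne'
  obtain ⟨u', rfl⟩ := hrange
  exact ⟨u', by simpa only [List.pairwise_map, Fin.succ_lt_succ_iff] using hu, rfl⟩

lemma exists_shiftWord_eq {u : List (Fin (n + 1))} (hu : u.Pairwise (· < ·)) :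
    ∃ b u', u'.Pairwise (· < ·) ∧ shiftWord b u' = u := by
  by_cases hpos : ∀ j ∈ u, 0 < j
  · obtain ⟨u', hu', rfl⟩ := exists_map_succ_eq hu hpos
    exact ⟨false, u', hu', rfl⟩
  · cases u with
    | nil => simp at hpos
    | cons j u =>
      rw [List.pairwise_cons] at hu
      obtain rfl : j = 0 := by
        by_contra hj
        have hj := Fin.pos_iff_ne_zero.2 hj
        exact hpos (List.forall_mem_cons.2 ⟨hj, fun i hi => hj.trans (hu.1 i hi)⟩)
      obtain ⟨u', hu', rfl⟩ := exists_map_succ_eq hu.2 hu.1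
      exact ⟨true, u', hu', rfl⟩

lemma wordProd_cons_shiftWord (x : E) (g : Fin n → E) (b : Bool) (u : List (Fin n)) :
    wordProd (Fin.cons x g : Fin (n + 1) → E) (shiftWord b u) = x ^ b.toNat * wordProd g u := by
  simp [wordProd, shiftWord, Function.comp_def]

lemma wordProd_tmul_mul_tmul {P : M} (ha : a * P = P) (u : List (Fin n)) (y : E) :
    wordProd (fun j => e j ⊗ₜ[k] a) u * y ⊗ₜ P = (wordProd e u * y) ⊗ₜ P := by
  induction u with
  | nil => simp
  | cons j u ih => simp [mul_assoc, ih, ha]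

lemma wordProd_add_tmul_mul_tmul {P : M} (hb : b * P = P) (hc : c * P = 0) (u : List (Fin n))
    (y : E) :
    wordProd (fun j => f j ⊗ₜ[k] b + e j ⊗ₜ c) u * y ⊗ₜ P = (wordProd f u * y) ⊗ₜ P := by
  induction u with
  | nil => simp
  | cons j u ih => simp [mul_assoc, ih, add_mul, hb, hc]

lemma wordProd_shiftWord_mul_tmul {P : M} (haφ : Commute a φ) (ha : a * P = P) (hb : b * P = P)
    (hc : c * P = 0) (s t : Bool) (u v : List (Fin n)) :
    wordProd (Fin.cons (1 ⊗ₜ ε) fun j => e j ⊗ₜ a : Fin (n + 1) → E ⊗[k] M) (shiftWord s u) *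
        wordProd (Fin.cons (1 ⊗ₜ φ) fun j => f j ⊗ₜ b + e j ⊗ₜ c : Fin (n + 1) → E ⊗[k] M)
          (shiftWord t v) * 1 ⊗ₜ P =
      (wordProd e u * wordProd f v) ⊗ₜ (ε ^ s.toNat * (φ ^ t.toNat * P)) := by
  have haφP : a * (φ ^ t.toNat * P) = φ ^ t.toNat * P := by
    rw [← mul_assoc, (haφ.pow_right _).eq, mul_assoc, ha]
  simp only [wordProd_cons_shiftWord, mul_assoc, wordProd_add_tmul_mul_tmul hb hc, mul_one,
    Algebra.TensorProduct.tmul_pow, one_pow, Algebra.TensorProduct.tmul_mul_tmul, one_mul,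
    wordProd_tmul_mul_tmul haφP]

end Extension

section Corner

variable {k : Type*} [Field k] {q : k}

/-- Left multiplication by `e` on the span of `1, f, e, ef`, for a braided pair `e, f` of
single letters. -/
def cornerLeft (k : Type*) [Field k] : Matrix (Fin 4) (Fin 4) k :=
  !![0, 0, 0, 0; 0, 0, 0, 0; 1, 0, 0, 0; 0, 1, 0, 0]

/-- Left multiplication by `f` on the span of `1, f, e, ef`, for a braided pair `e, f` of
single letters. -/
def cornerRight (q : k) : Matrix (Fin 4) (Fin 4) k :=
  !![0, 0, 0, 0; 1, 0, 0, 0; 0, 0, 0, 0; 0, 0, q⁻¹, 0]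

/-- The coefficient of the new left letters on the span of `1, f, e, ef`. -/
def twistLeft (q : k) : Matrix (Fin 4) (Fin 4) k :=
  !![1, 0, 0, 0; 0, 1, 0, 0; 0, 0, -q, 0; 0, 0, 0, -q]

/-- The diagonal coefficient of the new right letters on the span of `1, f, e, ef`. -/
def twistRight (q : k) : Matrix (Fin 4) (Fin 4) k :=
  !![1, 0, 0, 0; 0, -q, 0, 0; 0, 0, 1, 0; 0, 0, 0, -q]

/-- The coefficient by which the left letters enter the new right letters; it maps `e` to a
multiple of `f`. -/
def twistMixed (q : k) : Matrix (Fin 4) (Fin 4) k :=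
  !![0, 0, 0, 0; 0, 0, q⁻¹ - q, 0; 0, 0, 0, 0; 0, 0, 0, 0]

/-- The projection of the span of `1, f, e, ef` onto the line of `1`. -/
def vacuum (k : Type*) [Field k] : Matrix (Fin 4) (Fin 4) k :=
  !![1, 0, 0, 0; 0, 0, 0, 0; 0, 0, 0, 0; 0, 0, 0, 0]

/-- The position of the basis vector with the given exponents among `1, f, e, ef`. -/
def cornerIndex : Bool → Bool → Fin 4
  | false, false => 0
  | false, true => 1
  | true, false => 2
  | true, true => 3

lemma isBraidedExtension_corner (hq : q ≠ 0) :
    IsBraidedExtension q (cornerLeft k) (cornerRight q) (twistLeft q) (twistRight q)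
      (twistMixed q) := by
  constructor <;>
    simp [cornerLeft, cornerRight, twistLeft, twistRight, twistMixed, hq, mul_sub, sub_mul] <;>
    simp [-Matrix.zero_empty, ← Matrix.zero_empty]

lemma twistLeft_mul_vacuum : twistLeft q * vacuum k = vacuum k := by
  simp [twistLeft, vacuum]

lemma twistRight_mul_vacuum : twistRight q * vacuum k = vacuum k := by
  simp [twistRight, vacuum]

lemma twistMixed_mul_vacuum : twistMixed q * vacuum k = 0 := by
  simp [twistMixed, vacuum, -Matrix.zero_empty, ← Matrix.zero_empty]

lemma corner_mul_vacuum_apply (s t s' t' : Bool) :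
    (cornerLeft k ^ s.toNat * (cornerRight q ^ t.toNat * vacuum k)) (cornerIndex s' t') 0 =
      if s = s' ∧ t = t' then 1 else 0 := by
  cases s <;> cases t <;> cases s' <;> cases t' <;>
    simp [cornerLeft, cornerRight, vacuum, cornerIndex]

end Corner

theorem exists_braidedPair.{u} {k : Type u} [Field k] {q : k} (hq : q ≠ 0) (n : ℕ) :
    ∃ (E : Type u) (_ : Ring E) (_ : Algebra k E) (e f : Fin n → E), IsBraidedPair q e f ∧
      ∀ I J : List (Fin n), I.Pairwise (· < ·) → J.Pairwise (· < ·) →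
        ∃ θ : E →ₗ[k] k, ∀ u v : List (Fin n), u.Pairwise (· < ·) → v.Pairwise (· < ·) →
          θ (wordProd e u * wordProd f v) = if u = I ∧ v = J then 1 else 0 := by
  induction n with
  | zero =>
    refine ⟨k, inferInstance, inferInstance, Fin.elim0, Fin.elim0, ?_, fun I J _ _ =>
      ⟨LinearMap.id, fun u v _ _ => ?_⟩⟩
    · exact ⟨⟨fun j => j.elim0, fun {j} => j.elim0⟩, ⟨fun j => j.elim0, fun {j} => j.elim0⟩,
        fun j => j.elim0⟩
    · rw [Subsingleton.elim I u, Subsingleton.elim J v, Subsingleton.elim u [],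
        Subsingleton.elim v []]
      simp
  | succ n ih =>
    obtain ⟨E, _, _, e, f, h, hθ⟩ := ih
    refine ⟨E ⊗[k] Matrix (Fin 4) (Fin 4) k, inferInstance, inferInstance, _, _,
      h.cons_tmul hq (isBraidedExtension_corner hq), fun I J hI hJ => ?_⟩
    obtain ⟨s, I, hI', rfl⟩ := exists_shiftWord_eq hI
    obtain ⟨t, J, hJ', rfl⟩ := exists_shiftWord_eq hJ
    obtain ⟨θ, hθ⟩ := hθ I J hI' hJ'
    let entry : Matrix (Fin 4) (Fin 4) k →ₗ[k] k := Matrix.entryLinearMap k k (cornerIndex s t) 0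
    refine ⟨LinearMap.mul' k k ∘ₗ TensorProduct.map θ entry ∘ₗ
      LinearMap.mulRight k (1 ⊗ₜ vacuum k), fun u v hu hv => ?_⟩
    obtain ⟨s', u, hu', rfl⟩ := exists_shiftWord_eq hu
    obtain ⟨t', v, hv', rfl⟩ := exists_shiftWord_eq hv
    rw [LinearMap.comp_apply, LinearMap.comp_apply, LinearMap.mulRight_apply,
      wordProd_shiftWord_mul_tmul (isBraidedExtension_corner hq).a_mul_φ twistLeft_mul_vacuum
        twistRight_mul_vacuum twistMixed_mul_vacuum, TensorProduct.map_tmul,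
      LinearMap.mul'_apply, hθ u v hu' hv', Matrix.entryLinearMap_apply, corner_mul_vacuum_apply]
    simp only [shiftWord_inj, ite_zero_mul_ite_zero, mul_one]
    grind

end BraidedPair

/-! ### Words in a quantum exterior algebra -/

section Words

variable {k : Type*} [Field k] {q : k} {α E : Type*} [LinearOrder α] [Ring E] [Algebra k E]
variable {e f : α → E}

/-- The number of inversions of a word. -/
def inversions : List α → ℕ
  | [] => 0
  | a :: w => w.countP (· < a) + inversions w

lemma countP_ofFn {β : Type*} (p : β → Bool) {m : ℕ} (g : Fin m → β) :
    (List.ofFn g).countP p = ∑ i, if p (g i) then 1 else 0 := by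
  induction m with
  | zero => simp
  | succ m ih => rw [List.ofFn_succ, List.countP_cons, ih, Fin.sum_univ_succ, add_comm]

lemma inversions_ofFn {m : ℕ} (g : Fin m → α) :
    inversions (List.ofFn g) =
      (Finset.univ.filter fun p : Fin m × Fin m => p.1 < p.2 ∧ g p.2 < g p.1).card := by
  induction m with
  | zero => simp [inversions]
  | succ m ih =>
    rw [List.ofFn_succ, inversions, ih, countP_ofFn, Finset.card_filter, Finset.card_filter]
    simp [Fintype.sum_prod_type, Fin.sum_univ_succ, -Finset.sum_boole]

namespace IsQuantumExterior

lemma exists_mul_eq_smul (h : IsQuantumExterior q e) (hq : q ≠ 0) (a b : α) :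
    ∃ c : k, c ≠ 0 ∧ e a * e b = c • (e b * e a) := by
  obtain hlt | rfl | hlt := lt_trichotomy a b
  · refine ⟨(-q)⁻¹, inv_ne_zero (neg_ne_zero.2 hq), ?_⟩
    rw [h.anti hlt, inv_smul_smul₀ (neg_ne_zero.2 hq)]
  · exact ⟨1, one_ne_zero, (one_smul k _).symm⟩
  · exact ⟨-q, neg_ne_zero.2 hq, h.anti hlt⟩

lemma mul_wordProd_eq_zero (h : IsQuantumExterior q e) (hq : q ≠ 0) {a : α} {w : List α}
    (ha : a ∈ w) : e a * wordProd e w = 0 := by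
  induction w with
  | nil => simp at ha
  | cons b w ih =>
    rw [wordProd_cons, ← mul_assoc]
    obtain rfl | hab := eq_or_ne a b
    · rw [h.sq, zero_mul]
    · obtain ⟨c, -, hc⟩ := h.exists_mul_eq_smul hq a b
      rw [hc, smul_mul_assoc, mul_assoc, ih ((List.mem_cons.1 ha).resolve_left hab), mul_zero,
        smul_zero]

lemma wordProd_eq_zero (h : IsQuantumExterior q e) (hq : q ≠ 0) {w : List α} (hw : ¬ w.Nodup) :
    wordProd e w = 0 := by
  induction w with
  | nil => simp at hw
  | cons a w ih =>
    rw [wordProd_cons]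
    by_cases ha : a ∈ w
    · exact h.mul_wordProd_eq_zero hq ha
    · rw [ih fun hw' => hw (List.nodup_cons.2 ⟨ha, hw'⟩), mul_zero]

lemma mul_wordProd_of_pairwise (h : IsQuantumExterior q e) (a : α) {w : List α}
    (hw : w.Pairwise (· ≤ ·)) :
    e a * wordProd e w = (-q) ^ w.countP (· < a) • wordProd e (w.orderedInsert (· ≤ ·) a) := by
  induction w with
  | nil => simp
  | cons b w ih =>
    rw [List.pairwise_cons] at hw
    by_cases hab : a ≤ b
    · have hcount : (b :: w).countP (· < a) = 0 := by
        simp only [List.countP_eq_zero, List.forall_mem_cons, decide_eq_true_eq, not_lt]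
        exact ⟨hab, fun c hc => hab.trans (hw.1 c hc)⟩
      rw [hcount, List.orderedInsert_cons, if_pos hab, pow_zero, one_smul, wordProd_cons e a]
    · rw [List.orderedInsert_cons, if_neg hab, wordProd_cons, wordProd_cons, ← mul_assoc,
        h.anti (not_le.1 hab), smul_mul_assoc, mul_assoc, ih hw.2, mul_smul_comm, smul_smul,
        List.countP_cons_of_pos (by simpa using hab), pow_succ']

lemma wordProd_eq_smul_insertionSort (h : IsQuantumExterior q e) (w : List α) :
    wordProd e w = (-q) ^ inversions w • wordProd e (w.insertionSort (· ≤ ·)) := by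
  induction w with
  | nil => simp [inversions]
  | cons a w ih =>
    rw [wordProd_cons, ih, mul_smul_comm,
      h.mul_wordProd_of_pairwise a (List.pairwise_insertionSort _ w), smul_smul,
      List.insertionSort_cons, inversions, pow_add, mul_comm,
      (List.perm_insertionSort (· ≤ ·) w).countP_eq]

lemma wordProd_ofFn_comp_perm {m : ℕ} (h : IsQuantumExterior q e) (J : Fin m ↪o α)
    (σ : Equiv.Perm (Fin m)) :
    wordProd e (List.ofFn fun a => J (σ a)) =
      (-q) ^ permLength σ • wordProd e (List.ofFn J) := by
  have hsort : (List.ofFn fun a => J (σ a)).insertionSort (· ≤ ·) = List.ofFn J := by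
    refine List.Perm.eq_of_pairwise' (r := (· ≤ ·)) (List.pairwise_insertionSort _ _) ?_
      ((List.perm_insertionSort _ _).trans (Equiv.Perm.ofFn_comp_perm σ J))
    exact List.pairwise_ofFn.2 fun a b hab => J.monotone hab.le
  rw [h.wordProd_eq_smul_insertionSort, inversions_ofFn, hsort]
  simp only [J.lt_iff_lt, permLength]

end IsQuantumExterior

/-! ### Words in a braided pair -/

namespace IsBraidedPair

lemma mul_wordProd_of_lt (h : IsBraidedPair q e f) {a : α} {w : List α} (hw : ∀ b ∈ w, b < a) :
    e a * wordProd f w = wordProd f w * e a := by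
  induction w with
  | nil => simp
  | cons b w ih =>
    rw [List.forall_mem_cons] at hw
    rw [wordProd_cons, ← mul_assoc, h.braid, braidCoeff_of_gt hw.1, zero_smul, add_zero,
      mul_assoc, ih hw.2, mul_assoc]

lemma mul_wordProd_of_gt (h : IsBraidedPair q e f) (hq : q ≠ 0) {a : α} {w : List α}
    (hw : ∀ b ∈ w, a < b) : f a * e a * wordProd f w = f a * wordProd f w * e a := by
  induction w with
  | nil => simp
  | cons b w ih =>
    rw [List.forall_mem_cons] at hw
    obtain ⟨c, -, hc⟩ := h.right.exists_mul_eq_smul hq a b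
    -- The correction term of the braiding is killed by the factor `f a` in front of it.
    calc f a * e a * wordProd f (b :: w)
        = f a * (e a * f b) * wordProd f w := by simp only [wordProd_cons, mul_assoc]
      _ = f a * f b * e a * wordProd f w := by
          rw [h.braid, mul_add, mul_smul_comm, ← mul_assoc (f a) (f a), h.right.sq, zero_mul,
            smul_zero, add_zero, ← mul_assoc]
      _ = c • (f b * (f a * e a * wordProd f w)) := by
          simp only [hc, smul_mul_assoc, mul_assoc]
      _ = f a * wordProd f (b :: w) * e a := by
          rw [ih hw.2, wordProd_cons, ← mul_assoc (f a), hc]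
          simp only [smul_mul_assoc, mul_assoc]

lemma mul_wordProd_of_mem (h : IsBraidedPair q e f) (hq : q ≠ 0) {a : α} {w : List α}
    (hw : w.Pairwise (· < ·)) (ha : a ∈ w) :
    e a * wordProd f w = q • (wordProd f w * e a) := by
  obtain ⟨s, t, rfl⟩ := List.append_of_mem ha
  rw [List.pairwise_append, List.pairwise_cons] at hw
  have hs := h.mul_wordProd_of_lt fun b hb => hw.2.2 b hb a List.mem_cons_self
  have ht := h.mul_wordProd_of_gt hq hw.2.1.1
  have hself : e a * f a = q • (f a * e a) := by
    rw [h.braid, braidCoeff_self]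
    module
  calc e a * wordProd f (s ++ a :: t)
      = wordProd f s * (e a * f a) * wordProd f t := by
        rw [wordProd_append, wordProd_cons, ← mul_assoc, hs]
        simp only [mul_assoc]
    _ = q • (wordProd f s * (f a * e a * wordProd f t)) := by
        rw [hself]
        simp only [smul_mul_assoc, mul_smul_comm, mul_assoc]
    _ = q • (wordProd f (s ++ a :: t) * e a) := by
        rw [ht, wordProd_append, wordProd_cons]
        simp only [mul_assoc]

lemma wordProd_mul_wordProd (h : IsBraidedPair q e f) (hq : q ≠ 0) {v w : List α}
    (hw : w.Pairwise (· < ·)) (hv : v ⊆ w) :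
    wordProd e v * wordProd f w = q ^ v.length • (wordProd f w * wordProd e v) := by
  induction v with
  | nil => simp
  | cons a v ih =>
    rw [List.cons_subset] at hv
    rw [wordProd_cons, mul_assoc, ih hv.2, mul_smul_comm, ← mul_assoc,
      h.mul_wordProd_of_mem hq hw hv.1, smul_mul_assoc, smul_smul, mul_assoc, List.length_cons,
      pow_succ]

end IsBraidedPair

end Words

/-! ### Row sums of a quantum matrix in a quantum exterior algebra -/

section RowSums

lemma prod_ofFn_mul_of_commute {M : Type*} [Monoid M] {m : ℕ} {a b : Fin m → M}
    (h : ∀ i j, Commute (a i) (b j)) :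
    (List.ofFn fun i => a i * b i).prod = (List.ofFn a).prod * (List.ofFn b).prod := by
  induction m with
  | zero => simp
  | succ m ih =>
    have hb : Commute (b 0) (List.ofFn fun i : Fin m => a i.succ).prod := by
      refine Commute.list_prod_right _ _ fun y hy => ?_
      obtain ⟨i, rfl⟩ := List.mem_ofFn.1 hy
      exact (h _ _).symm
    simp only [List.ofFn_succ, List.prod_cons, ih fun i j => h i.succ j.succ]
    rw [mul_assoc, mul_assoc, hb.left_comm]

section Words

variable {m : ℕ} {α : Type*} [LinearOrder α]

lemma orderEmbedding_comp_perm_injective :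
    Function.Injective fun (p : (Fin m ↪o α) × Equiv.Perm (Fin m)) a => p.1 (p.2 a) := by
  rintro ⟨J, σ⟩ ⟨J', σ'⟩ h
  have hrange (J : Fin m ↪o α) (σ : Equiv.Perm (Fin m)) :
      Set.range (fun a => J (σ a)) = Set.range J := σ.surjective.range_comp J
  obtain rfl : J = J' := DFunLike.coe_injective <|
    (J.strictMono.range_inj J'.strictMono).1 <| by
      rw [← hrange J σ, ← hrange J' σ']
      exact congrArg Set.range h
  exact Prod.ext rfl (Equiv.ext fun a => J.injective (congrFun h a))

lemma exists_orderEmbedding_comp_perm_eq {g : Fin m → α} (hg : Function.Injective g) :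
    ∃ p : (Fin m ↪o α) × Equiv.Perm (Fin m), (fun a => p.1 (p.2 a)) = g := by
  have hmono : StrictMono (g ∘ Tuple.sort g) :=
    (Tuple.monotone_sort g).strictMono_of_injective (hg.comp (Tuple.sort g).injective)
  exact ⟨(OrderEmbedding.ofStrictMono _ hmono, (Tuple.sort g).symm), funext fun a => by simp⟩

end Words

/-- Expanding the product, words with a repeated letter vanish, and sorting the others produces
the quantum minors. -/
lemma IsQuantumExterior.prod_ofFn_sum {k A : Type*} [Field k] [Ring A] [Algebra k A] {q : k}
    {m n : ℕ} {x : Fin m → Fin n → A} {e : Fin n → A} (he : IsQuantumExterior q e) (hq : q ≠ 0)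
    (hxe : ∀ i j l, Commute (x i j) (e l)) :
    (List.ofFn fun i => ∑ j, x i j * e j).prod =
      ∑ J : Fin m ↪o Fin n, (∑ σ : Equiv.Perm (Fin m),
        (-q) ^ permLength σ • (List.ofFn fun a => x a (J (σ a))).prod) *
          wordProd e (List.ofFn J) := by
  have hterm (g : Fin m → Fin n) : (List.ofFn fun i => x i (g i) * e (g i)).prod =
      (List.ofFn fun i => x i (g i)).prod * wordProd e (List.ofFn g) := by
    rw [prod_ofFn_mul_of_commute fun i j => hxe _ _ _, wordProd, List.map_ofFn]
    rfl
  have hexpand := (MultilinearMap.mkPiAlgebraFin k m A).map_sum fun i j => x i j * e j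
  simp only [MultilinearMap.mkPiAlgebraFin_apply, hterm] at hexpand
  simp only [hexpand, Finset.sum_mul]
  rw [← Fintype.sum_prod_type']
  refine (Fintype.sum_of_injective _ orderEmbedding_comp_perm_injective _ _ (fun g hg => ?_)
    fun p => ?_).symm
  · rw [he.wordProd_eq_zero hq, mul_zero]
    exact fun hnodup => hg (exists_orderEmbedding_comp_perm_eq (List.nodup_ofFn.1 hnodup))
  · rw [he.wordProd_ofFn_comp_perm, smul_mul_assoc, mul_smul_comm]

end RowSums

/-! ### Reordering words in a braided pair -/

section Reordering

lemma exists_perm_map_inl_append_map_inr {α β : Type*} (w : List (α ⊕ β)) :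
    ∃ (u : List α) (v : List β), w.Perm (u.map Sum.inl ++ v.map Sum.inr) := by
  induction w with
  | nil => exact ⟨[], [], List.Perm.refl _⟩
  | cons a w ih =>
    obtain ⟨u, v, h⟩ := ih
    cases a with
    | inl a => exact ⟨a :: u, v, h.cons _⟩
    | inr a => exact ⟨u, a :: v, (h.cons _).trans List.perm_middle.symm⟩

/-- The sum of the indices of the right letters of a word in two alphabets. The braiding of a
pair replaces `e j * f l` by `f l * e j` and, when `j < l`, a term `f j * e l` of smaller
weight. -/
def rightWeight (n : ℕ) : Multiset (Fin n ⊕ Fin n) →+ ℕ where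
  toFun s := (s.map (Sum.elim (fun _ => 0) Fin.val)).sum
  map_zero' := by simp
  map_add' s t := by simp

variable {k E : Type*} [Field k] [Ring E] [Algebra k E] {q : k} {n : ℕ} {e f : Fin n → E}

lemma rightWeight_apply (s : Multiset (Fin n ⊕ Fin n)) :
    rightWeight n s = (s.map (Sum.elim (fun _ => 0) Fin.val)).sum := rfl

lemma rightWeight_map_inl_append_map_inr (u v : List (Fin n)) :
    rightWeight n (u.map Sum.inl ++ v.map Sum.inr : List (Fin n ⊕ Fin n)) =
      (v.map Fin.val).sum := by
  simp [rightWeight_apply, Function.comp_def]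

lemma wordProd_elim_map_inl (u : List (Fin n)) :
    wordProd (Sum.elim e f) (u.map Sum.inl) = wordProd e u := by
  simp [wordProd, Function.comp_def]

lemma wordProd_elim_map_inr (v : List (Fin n)) :
    wordProd (Sum.elim e f) (v.map Sum.inr) = wordProd f v := by
  simp [wordProd, Function.comp_def]

namespace IsBraidedPair

lemma exists_braid_sub_mem_lowerSpan (h : IsBraidedPair q e f) (hq : q ≠ 0) (j l : Fin n) :
    ∃ c : k, c ≠ 0 ∧ e j * f l - c • (f l * e j) ∈
      lowerSpan k (Sum.elim e f) (rightWeight n) l := by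
  obtain hjl | rfl | hlj := lt_trichotomy j l
  · refine ⟨1, one_ne_zero, ?_⟩
    rw [h.braid, one_smul, add_sub_cancel_left]
    refine Submodule.smul_mem _ _ (Submodule.subset_span ⟨[.inr j, .inl l], ?_, by simp⟩)
    simpa [rightWeight_apply] using hjl
  · refine ⟨q, hq, ?_⟩
    have hself : e j * f j = q • (f j * e j) := by
      rw [h.braid, braidCoeff_self]
      module
    simp [hself]
  · refine ⟨1, one_ne_zero, ?_⟩
    rw [h.braid, braidCoeff_of_gt hlj]
    simp

lemma quasiCommutes (h : IsBraidedPair q e f) (hq : q ≠ 0) :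
    QuasiCommutes k (Sum.elim e f) (rightWeight n) := by
  rintro (i | i) (j | j)
  · obtain ⟨c, hc, hij⟩ := h.left.exists_mul_eq_smul hq i j
    exact ⟨c, hc, by simp [hij]⟩
  · simpa [rightWeight_apply] using h.exists_braid_sub_mem_lowerSpan hq i j
  · obtain ⟨c, hc, hji⟩ := h.exists_braid_sub_mem_lowerSpan hq j i
    refine ⟨c⁻¹, inv_ne_zero hc, ?_⟩
    convert Submodule.smul_mem _ (-c⁻¹) hji using 1
    · simp [rightWeight_apply]
    · rw [smul_sub, neg_smul, neg_smul, inv_smul_smul₀ hc]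
      simp [sub_eq_add_neg, add_comm]
  · obtain ⟨c, hc, hij⟩ := h.right.exists_mul_eq_smul hq i j
    exact ⟨c, hc, by simp [hij]⟩

lemma lowerSpan_le_ker (h : IsBraidedPair q e f) (hq : q ≠ 0) {θ : E →ₗ[k] k} {γ : ℕ}
    (hθ : ∀ u v : List (Fin n), u.Pairwise (· < ·) → v.Pairwise (· < ·) →
      (v.map Fin.val).sum < γ → θ (wordProd e u * wordProd f v) = 0) :
    lowerSpan k (Sum.elim e f) (rightWeight n) γ ≤ θ.ker := by
  refine (h.quasiCommutes hq).lowerSpan_le γ fun w hw => ?_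
  obtain ⟨u, v, huv⟩ := exists_perm_map_inl_append_map_inr w
  have hu := List.perm_insertionSort (· ≤ ·) u
  have hv := List.perm_insertionSort (· ≤ ·) v
  refine ⟨_, huv.trans ((hu.symm.map _).append (hv.symm.map _)), ?_⟩
  rw [wordProd_append, wordProd_elim_map_inl, wordProd_elim_map_inr, LinearMap.mem_ker]
  by_cases hu' : u.Nodup
  · by_cases hv' : v.Nodup
    · refine hθ _ _ ?_ ?_ ?_
      · exact (List.sortedLE_insertionSort.sortedLT_of_nodup (hu.nodup_iff.2 hu')).pairwise
      · exact (List.sortedLE_insertionSort.sortedLT_of_nodup (hv.nodup_iff.2 hv')).pairwise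
      · rwa [(hv.map Fin.val).sum_eq, ← rightWeight_map_inl_append_map_inr u v,
          ← Multiset.coe_eq_coe.2 huv]
    · rw [h.right.wordProd_eq_zero hq (mt hv.nodup_iff.1 hv'), mul_zero, map_zero]
  · rw [h.left.wordProd_eq_zero hq (mt hu.nodup_iff.1 hu'), zero_mul, map_zero]

lemma exists_apply_mul_comm (h : IsBraidedPair q e f) (hq : q ≠ 0) {θ : E →ₗ[k] k} {γ : ℕ}
    (hθ : ∀ u v : List (Fin n), u.Pairwise (· < ·) → v.Pairwise (· < ·) →
      (v.map Fin.val).sum < γ → θ (wordProd e u * wordProd f v) = 0)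
    (u : List (Fin n)) {v : List (Fin n)} (hv : (v.map Fin.val).sum ≤ γ) :
    ∃ c : k, c ≠ 0 ∧
      θ (wordProd f v * wordProd e u) = c * θ (wordProd e u * wordProd f v) := by
  obtain ⟨c, hc, hmem⟩ := (h.quasiCommutes hq).wordProd_perm
    (List.perm_append_comm (l₁ := v.map Sum.inr) (l₂ := u.map Sum.inl))
  rw [Multiset.coe_eq_coe.2 List.perm_append_comm, rightWeight_map_inl_append_map_inr] at hmem
  have hker := h.lowerSpan_le_ker hq hθ (lowerSpan_mono hv hmem)
  refine ⟨c, hc, ?_⟩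
  simpa only [LinearMap.mem_ker, map_sub, map_smul, smul_eq_mul, sub_eq_zero, wordProd_append,
    wordProd_elim_map_inl, wordProd_elim_map_inr] using hker

end IsBraidedPair

end Reordering

/-! ### Exchange relations between maximal minors -/

section Exchange

open scoped TensorProduct

/-- The sum of the column indices of a maximal minor. -/
def columnSum {m n : ℕ} (J : Fin m ↪o Fin n) : ℕ := ∑ a, (J a : ℕ)

section Columns

variable {m n : ℕ} (J : Fin m ↪o Fin n)

lemma columnSum_le : columnSum J ≤ m * n :=
  (Finset.sum_le_card_nsmul _ _ n fun a _ => (J a).2.le).trans (by simp)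

lemma sum_map_val_ofFn : ((List.ofFn J).map Fin.val).sum = columnSum J := by
  rw [List.map_ofFn, List.sum_ofFn]
  rfl

lemma pairwise_ofFn_orderEmbedding : (List.ofFn J).Pairwise (· < ·) :=
  List.pairwise_ofFn.2 fun _ _ h => J.strictMono h

end Columns

lemma exists_braidedPair_functional.{u} {k : Type u} [Field k] {q : k} {m n : ℕ} (hq : q ≠ 0)
    (I J : Fin m ↪o Fin n) :
    ∃ (E : Type u) (_ : Ring E) (_ : Algebra k E) (e f : Fin n → E) (θ : E →ₗ[k] k),
      IsBraidedPair q e f ∧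
      (∀ p : (Fin m ↪o Fin n) × (Fin m ↪o Fin n),
        θ (wordProd e (List.ofFn p.1) * wordProd f (List.ofFn p.2)) =
          if p = (I, J) then 1 else 0) ∧
      θ (wordProd f (List.ofFn J) * wordProd e (List.ofFn I)) ≠ 0 ∧
      ∀ p : (Fin m ↪o Fin n) × (Fin m ↪o Fin n), p ≠ (I, J) → columnSum p.2 ≤ columnSum J →
        θ (wordProd f (List.ofFn p.2) * wordProd e (List.ofFn p.1)) = 0 := by
  obtain ⟨E, _, _, e, f, h, hθ⟩ := exists_braidedPair hq n
  obtain ⟨θ, hθ⟩ := hθ _ _ (pairwise_ofFn_orderEmbedding I) (pairwise_ofFn_orderEmbedding J)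
  have hdual (p : (Fin m ↪o Fin n) × (Fin m ↪o Fin n)) :
      θ (wordProd e (List.ofFn p.1) * wordProd f (List.ofFn p.2)) =
        if p = (I, J) then 1 else 0 := by
    rw [hθ _ _ (pairwise_ofFn_orderEmbedding _) (pairwise_ofFn_orderEmbedding _)]
    simp only [List.ofFn_injective.eq_iff, DFunLike.coe_fn_eq, Prod.ext_iff]
  have hlower (u v : List (Fin n)) (hu : u.Pairwise (· < ·)) (hv : v.Pairwise (· < ·))
      (hvJ : (v.map Fin.val).sum < columnSum J) : θ (wordProd e u * wordProd f v) = 0 := by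
    rw [hθ u v hu hv, if_neg]
    rintro ⟨-, rfl⟩
    exact hvJ.ne (sum_map_val_ofFn J)
  have hswap (p : (Fin m ↪o Fin n) × (Fin m ↪o Fin n)) (hp : columnSum p.2 ≤ columnSum J) :=
    h.exists_apply_mul_comm hq hlower (List.ofFn p.1) ((sum_map_val_ofFn p.2).trans_le hp)
  refine ⟨E, inferInstance, inferInstance, e, f, θ, h, hdual, ?_, fun p hne hp => ?_⟩
  · obtain ⟨c, hc, heq⟩ := hswap (I, J) le_rfl
    rw [heq, hdual (I, J), if_pos rfl, mul_one]
    exact hc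
  · obtain ⟨c, -, heq⟩ := hswap p hp
    rw [heq, hdual p, if_neg hne, mul_zero]

namespace QMat

variable {k : Type*} [Field k] {q : k} {m n : ℕ}

/-- The maximal quantum minor with the given columns. -/
noncomputable def maxMinor (q : k) (J : Fin m ↪o Fin n) : QMat q m n :=
  minor q (RelEmbedding.refl _) J

section Tensor

variable {E : Type*} [Ring E] [Algebra k E] {e f : Fin n → E}

lemma prod_ofFn_sum_tmul (he : IsQuantumExterior q e) (hq : q ≠ 0) :
    (List.ofFn fun i : Fin m => ∑ j, X q i j ⊗ₜ[k] e j).prod =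
      ∑ J : Fin m ↪o Fin n, maxMinor q J ⊗ₜ[k] wordProd e (List.ofFn J) := by
  let left : QMat q m n →ₐ[k] QMat q m n ⊗[k] E := Algebra.TensorProduct.includeLeft
  let right : E →ₐ[k] QMat q m n ⊗[k] E := Algebra.TensorProduct.includeRight
  have hmul (a : QMat q m n) (b : E) : left a * right b = a ⊗ₜ b := by simp [left, right]
  have hcomm (a : QMat q m n) (b : E) : Commute (left a) (right b) := by
    simp [left, right, Commute, SemiconjBy]
  have hexpand := (he.map right).prod_ofFn_sum (x := fun i j => left (X q i j)) hq
    fun i j l => hcomm _ _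
  simp only [hmul] at hexpand
  rw [hexpand]
  refine Finset.sum_congr rfl fun J _ => ?_
  rw [← hmul]
  simp [maxMinor, minor, wordProd, map_list_prod, List.map_ofFn, Function.comp_def]

lemma isBraidedPair_coact (hq : q ≠ 0) (h : IsBraidedPair q e f) :
    IsBraidedPair q (fun i : Fin m => ∑ j, X q i j ⊗ₜ[k] e j)
      fun i => ∑ j, X q i j ⊗ₜ[k] f j := by
  let left : QMat q m n →ₐ[k] QMat q m n ⊗[k] E := Algebra.TensorProduct.includeLeft
  let right : E →ₐ[k] QMat q m n ⊗[k] E := Algebra.TensorProduct.includeRight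
  have hcomm (a : QMat q m n) (b : E) : Commute (left a) (right b) := by
    simp [left, right, Commute, SemiconjBy]
  simpa [left, right] using (h.map right).coact hq ((isQuantumMatrix hq).map left)
    (fun i j l => hcomm _ _) fun i j l => hcomm _ _

lemma sum_maxMinor_tmul (hq : q ≠ 0) (h : IsBraidedPair q e f) :
    ∑ p : (Fin m ↪o Fin n) × (Fin m ↪o Fin n), (maxMinor q p.1 * maxMinor q p.2) ⊗ₜ[k]
        (wordProd e (List.ofFn p.1) * wordProd f (List.ofFn p.2)) =
      q ^ m • ∑ p : (Fin m ↪o Fin n) × (Fin m ↪o Fin n),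
        (maxMinor q p.2 * maxMinor q p.1) ⊗ₜ[k]
          (wordProd f (List.ofFn p.2) * wordProd e (List.ofFn p.1)) := by
  have hswap := (isBraidedPair_coact (m := m) hq h).wordProd_mul_wordProd hq
    (List.pairwise_lt_finRange m) (List.Subset.refl _)
  simp only [wordProd, ← List.ofFn_eq_map, List.length_finRange] at hswap
  rw [prod_ofFn_sum_tmul h.left hq, prod_ofFn_sum_tmul h.right hq] at hswap
  simp only [Finset.sum_mul_sum, Algebra.TensorProduct.tmul_mul_tmul] at hswap
  rw [Fintype.sum_prod_type, hswap, Finset.sum_comm, Fintype.sum_prod_type]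

end Tensor

lemma exchange (hq : q ≠ 0) (I J : Fin m ↪o Fin n) :
    ∃ c : k, c ≠ 0 ∧ maxMinor q I * maxMinor q J - c • (maxMinor q J * maxMinor q I) ∈
      Submodule.span k {x | ∃ J' I' : Fin m ↪o Fin n,
        columnSum J < columnSum J' ∧ x = maxMinor q J' * maxMinor q I'} := by
  obtain ⟨E, _, _, e, f, θ, h, hdual, hne, hzero⟩ := exists_braidedPair_functional hq I J
  have hsum := congrArg ((TensorProduct.rid k (QMat q m n)).toLinearMap ∘ₗ
    LinearMap.lTensor (QMat q m n) θ) (sum_maxMinor_tmul (m := m) hq h)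
  simp only [map_sum, map_smul, LinearMap.comp_apply, LinearMap.lTensor_tmul,
    LinearEquiv.coe_coe, TensorProduct.rid_tmul, hdual, ite_smul, one_smul, zero_smul,
    Finset.sum_ite_eq', Finset.mem_univ, if_true] at hsum
  refine ⟨q ^ m * θ (wordProd f (List.ofFn J) * wordProd e (List.ofFn I)),
    mul_ne_zero (pow_ne_zero _ hq) hne, ?_⟩
  rw [hsum, mul_smul, ← smul_sub, ← Finset.add_sum_erase _ _ (Finset.mem_univ (I, J)),
    add_sub_cancel_left]
  refine Submodule.smul_mem _ _ (Submodule.sum_mem _ fun p hp => ?_)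
  by_cases hJ : columnSum p.2 ≤ columnSum J
  · rw [hzero p (Finset.ne_of_mem_erase hp) hJ, zero_smul]
    exact zero_mem _
  · exact Submodule.smul_mem _ _ (Submodule.subset_span ⟨p.2, p.1, not_le.1 hJ, rfl⟩)

end QMat

end Exchange

/-! ### The quantum grassmannian -/

section Grassmannian

variable {k : Type*} [Field k] {q : k} {m n : ℕ}

/-- The weight of a maximal minor. A product of two minors one of which has column sum exceeding
those of both `I` and `J` has smaller weight than `[I] * [J]`, whatever its other factor. -/
def minorWeight (J : Fin m ↪o Fin n) : ℕ := 2 ^ (m * n) - 2 ^ columnSum J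

lemma minorWeight_add_lt {I J I' J' : Fin m ↪o Fin n} (hI : columnSum I < columnSum J')
    (hJ : columnSum J < columnSum J') :
    minorWeight J' + minorWeight I' < minorWeight I + minorWeight J := by
  have hle (K : Fin m ↪o Fin n) : 2 ^ columnSum K ≤ 2 ^ (m * n) :=
    Nat.pow_le_pow_right two_pos (columnSum_le K)
  have hI₂ := Nat.pow_le_pow_right two_pos (Nat.succ_le_of_lt hI)
  have hJ₂ := Nat.pow_le_pow_right two_pos (Nat.succ_le_of_lt hJ)
  have hI' := Nat.pow_pos (n := columnSum I') two_pos
  have := hle I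
  have := hle J
  have := hle I'
  have := hle J'
  rw [pow_succ] at hI₂ hJ₂
  simp only [minorWeight]
  omega

lemma QMat.maxMinor_weightedQuasiCommutes (hq : q ≠ 0) :
    WeightedQuasiCommutes k (QMat.maxMinor (m := m) (n := n) q) minorWeight := by
  intro I J
  obtain hle | hle := le_total (columnSum I) (columnSum J)
  · obtain ⟨c, hc, h⟩ := QMat.exchange hq I J
    refine ⟨c, hc, Submodule.span_mono ?_ h⟩
    rintro _ ⟨J', I', hJ, rfl⟩
    exact ⟨J', I', minorWeight_add_lt (hle.trans_lt hJ) hJ, rfl⟩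
  · obtain ⟨c, hc, h⟩ := QMat.exchange hq J I
    refine ⟨c⁻¹, inv_ne_zero hc, ?_⟩
    have hneg : QMat.maxMinor q I * QMat.maxMinor q J -
        c⁻¹ • (QMat.maxMinor q J * QMat.maxMinor q I) = -c⁻¹ •
          (QMat.maxMinor q J * QMat.maxMinor q I -
            c • (QMat.maxMinor q I * QMat.maxMinor q J)) := by
      rw [smul_sub, neg_smul, neg_smul, inv_smul_smul₀ hc]
      abel
    rw [hneg]
    refine Submodule.smul_mem _ _ (Submodule.span_mono ?_ h)
    rintro _ ⟨J', I', hI, rfl⟩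
    exact ⟨J', I', minorWeight_add_lt hI (hle.trans_lt hI), rfl⟩

lemma quantumGrassmannian_eq_adjoin :
    quantumGrassmannian q m n =
      Algebra.adjoin k (Set.range (QMat.maxMinor (m := m) (n := n) q)) := by
  have hrefl (I : Fin m ↪o Fin m) : I = RelEmbedding.refl _ :=
    DFunLike.coe_injective <| (I.strictMono.range_inj strictMono_id).1 <| by
      rw [(Finite.surjective_of_injective I.injective).range_eq, Set.range_id]
  rw [quantumGrassmannian]
  congr 1
  ext y
  constructor
  · rintro ⟨I, J, rfl⟩
    exact ⟨J, by rw [hrefl I, QMat.maxMinor]⟩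
  · rintro ⟨J, rfl⟩
    exact ⟨_, J, rfl⟩

end Grassmannian

/-- The quantum grassmannian is a (left and right) noetherian domain. -/
theorem mainTheorem1 {k : Type*} [Field k] (q : k) (hq : q ≠ 0) (m n : ℕ)
    (hm : 0 < m) (hmn : m ≤ n) :
    IsNoetherianRing (quantumGrassmannian q m n) ∧
      IsNoetherianRing (quantumGrassmannian q m n)ᵐᵒᵖ ∧
      IsDomain (quantumGrassmannian q m n) := by
  rw [quantumGrassmannian_eq_adjoin]
  have : IsDomain (QMat q m n) := QMat.isDomain hq
  obtain ⟨hleft, hright⟩ := (QMat.maxMinor_weightedQuasiCommutes hq).isNoetherianRing_adjoin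
  exact ⟨hleft, hright, inferInstance⟩
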